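/- Let $0<\alpha<1$. For $0<a<1$ let $z_a$ be the upper $a$-quantile of the standard normal distribution, and for integers $1\le X\le n-1$ put $\hat p=X/n$, $\hat q=1-\hat p$. Let $p_L=p_L(a,n,X)$ be the $a$-quantile of the $\mathrm{Beta}(X,n-X+1)$ distribution and $p_U=p_U(a,n,X)$ the $(1-a)$-quantile of the $\mathrm{Beta}(X+1,n-X)$ distribution. For $a=\alpha/2$ these are the endpoints of the two-sided $1-\alpha$ Clopper–Pearson interval, and for $a=\alpha$ they are the one-sided $1-\alpha$ Clopper–Pearson lower and upper bounds. In either case, $a\in\{\alpha/2,\alpha\}$, the following holds. (i) For all $1\le X\le n-1$, $p_L$ and $p_U$ are the unique points of $[0,1]$ with $$\sum_{k=X}^n\binom nk p_L^k(1-p_L)^{n-k}=a,\qquad \sum_{k=0}^X\binom nk p_U^k(1-p_U)^{n-k}=a .$$ (ii) As $n\to\infty$, uniformly over $X$ with $\hat p$ bounded away from $0$ and $1$, $$p_L=\hat p-n^{-1/2}z_a(\hat p\hat q)^{1/2}+(3n)^{-1}\Big(2(\tfrac12-\hat p)z_a^2-(1+\hat p)\Big)+O(n^{-3/2}),$$ $$p_U=\hat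 p+n^{-1/2}z_a(\hat p\hat q)^{1/2}+(3n)^{-1}\Big(2(\tfrac12-\hat p)z_a^2+1+\hat q\Big)+O(n^{-3/2}),$$ and, more precisely, $$p_L=\hat p-n^{-1/2}z_a(\hat p\hat q)^{1/2}+(3n)^{-1}\Big(2(\tfrac12-\hat p)z_a^2-(1+\hat p)\Big)-n^{-3/2}z_a(\hat p\hat q)^{1/2}\Big(-\tfrac{53}{36}-\tfrac{\frac12-\hat p}{\hat p}+\tfrac{z_a^2+11}{36\hat p\hat q}-\tfrac{13z_a^2}{36}\Big)+O(n^{-2}),$$ $$p_U=\hat p+n^{-1/2}z_a(\hat p\hat q)^{1/2}+(3n)^{-1}\Big(2(\tfrac12-\hat p)z_a^2+1+\hat q\Big)+n^{-3/2}z_a(\hat p\hat q)^{1/2}\Big(-\tfrac{53}{36}+\tfrac{\frac12-\hat p}{\hat q}+\tfrac{z_a^2+11}{36\hat p\hat q}-\tfrac{13z_a^2}{36}\Big)+O(n^{-2}).$$ That is, for every $\delta>0$ there is a constant $C$, depending only on $a$ and $\delta$, such that for all $1\le X\le n-1$ with $\delta\le\hat p\le1-\delta$ the four error terms are at most $Cn^{-3/2}$,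 $Cn^{-3/2}$, $Cn^{-2}$, $Cn^{-2}$ in absolute value. -/

import Mathlib

namespace ClopperPearson

/-- The `u`-quantile of a probability measure on the line: the generalised inverse of its
distribution function. -/
noncomputable def quantile (μ : MeasureTheory.Measure ℝ) (u : ℝ) : ℝ :=
  sInf {x : ℝ | u ≤ ProbabilityTheory.cdf μ x}

/-- The upper `a`-quantile `z_a` of the standard normal distribution. -/
noncomputable def zUpper (a : ℝ) : ℝ :=
  quantile (ProbabilityTheory.gaussianReal 0 1) (1 - a)

/-- The lower Clopper–Pearson limit with tail probability `a`: the `a`-quantile of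
`Beta(X, n - X + 1)`. The two-sided `1 - α` interval uses `a = α / 2`, the one-sided `1 - α`
lower bound uses `a = α`. -/
noncomputable def lower (a : ℝ) (n X : ℕ) : ℝ :=
  quantile (ProbabilityTheory.betaMeasure (X : ℝ) ((n : ℝ) - X + 1)) a

/-- The upper Clopper–Pearson limit with tail probability `a`: the `(1 - a)`-quantile of
`Beta(X + 1, n - X)`. -/
noncomputable def upper (a : ℝ) (n X : ℕ) : ℝ :=
  quantile (ProbabilityTheory.betaMeasure ((X : ℝ) + 1) ((n : ℝ) - X)) (1 - a)

/-- The probability that a `Bin(n, p)` variable is at least `X`. -/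
noncomputable def binomGE (n X : ℕ) (p : ℝ) : ℝ :=
  ∑ k ∈ Finset.Icc X n, (n.choose k : ℝ) * p ^ k * (1 - p) ^ (n - k)

/-- The probability that a `Bin(n, p)` variable is at most `X`. -/
noncomputable def binomLE (n X : ℕ) (p : ℝ) : ℝ :=
  ∑ k ∈ Finset.Icc 0 X, (n.choose k : ℝ) * p ^ k * (1 - p) ^ (n - k)

/-- Expansion of the lower limit through the `n⁻¹` term, with `p = X / n`. -/
noncomputable def lowerExp (n p z : ℝ) : ℝ :=
  p - n ^ (-(1 / 2) : ℝ) * z * (p * (1 - p)) ^ (1 / 2 : ℝ)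
    + (3 * n)⁻¹ * (2 * (1 / 2 - p) * z ^ 2 - (1 + p))

/-- Expansion of the upper limit through the `n⁻¹` term, with `p = X / n`. -/
noncomputable def upperExp (n p z : ℝ) : ℝ :=
  p + n ^ (-(1 / 2) : ℝ) * z * (p * (1 - p)) ^ (1 / 2 : ℝ)
    + (3 * n)⁻¹ * (2 * (1 / 2 - p) * z ^ 2 + (1 + (1 - p)))

/-- Expansion of the lower limit through the `n ^ (-3/2)` term, with `p = X / n`. -/
noncomputable def lowerExpRefined (n p z : ℝ) : ℝ :=
  lowerExp n p z
    - n ^ (-(3 / 2) : ℝ) * z * (p * (1 - p)) ^ (1 / 2 : ℝ)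
      * (-(53 / 36) - (1 / 2 - p) / p + (z ^ 2 + 11) / (36 * (p * (1 - p))) - 13 * z ^ 2 / 36)

/-- Expansion of the upper limit through the `n ^ (-3/2)` term, with `p = X / n`. -/
noncomputable def upperExpRefined (n p z : ℝ) : ℝ :=
  upperExp n p z
    + n ^ (-(3 / 2) : ℝ) * z * (p * (1 - p)) ^ (1 / 2 : ℝ)
      * (-(53 / 36) + (1 / 2 - p) / (1 - p) + (z ^ 2 + 11) / (36 * (p * (1 - p)))
          - 13 * z ^ 2 / 36)

end ClopperPearson

/-!
By the beta–binomial duality the lower limit is the root `p` of `G p = a`, where `G = binomGE n X`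
has the `Beta(X, n - X + 1)` density as its derivative. Put `ε = n ^ (-1/2)` and let `x z` be the
refined expansion of the lower limit as a function of the normal quantile `z`. The derivative of
`G (x z)` is `-K * φ z * exp (L z)`, where `K` does not depend on `z`. The two correction
polynomials in `x` are exactly those that cancel the terms of order `ε` and `ε ^ 2` of `L`, so
`L z` is at most `ε ^ 3` times a polynomial in `|z|` as long as `|z|` is at most a multiple of
`√(-log ε)`.
Beyond that range both the normal and the binomial tails are `O(ε ^ 3)`, which forces
`K = 1 + O(ε ^ 3)` without any recourse to Stirling's formula. Hence `G (x z) = 1 - Φ z + O(ε ^ 3)`,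
and since `x` has slope `O(ε)` and `Φ` has slope bounded below near `z_a`, monotonicity of `G` puts
its root within `O(ε ^ 4)` of `x z_a`. The upper limit follows from the symmetry
`(X, p) ↦ (n - X, 1 - p)`.
-/

namespace ClopperPearson

open MeasureTheory ProbabilityTheory Set Filter Topology

/-! ### Quantiles -/

theorem continuous_cdf (μ : Measure ℝ) [IsProbabilityMeasure μ] [NullSingletonClass μ] :
    Continuous (cdf μ) := by
  rw [continuous_iff_continuousAt]
  intro x
  rw [(cdf μ).mono.continuousAt_iff_leftLim_eq_rightLim, (cdf μ).rightLim_eq]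
  have hjump := (cdf μ).measure_singleton x
  rw [measure_cdf, measure_singleton, eq_comm, ENNReal.ofReal_eq_zero] at hjump
  exact le_antisymm ((cdf μ).mono.leftLim_le le_rfl) (by linarith)

theorem cdf_quantile (μ : Measure ℝ) [IsProbabilityMeasure μ] [NullSingletonClass μ] {u : ℝ}
    (h0 : 0 < u) (h1 : u < 1) : cdf μ (quantile μ u) = u := by
  have hc := continuous_cdf μ
  obtain ⟨x₀, hx₀⟩ := ((tendsto_cdf_atBot μ).eventually_lt_const h0).exists
  obtain ⟨x₁, hx₁⟩ := ((tendsto_cdf_atTop μ).eventually_const_lt h1).exists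
  obtain ⟨y, rfl⟩ : u ∈ range (cdf μ) :=
    mem_range_of_exists_le_of_exists_ge hc ⟨x₀, hx₀.le⟩ ⟨x₁, hx₁.le⟩
  have hbdd : BddBelow {x | cdf μ y ≤ cdf μ x} :=
    ⟨x₀, fun x hx => (monotone_cdf μ).reflect_lt (hx₀.trans_le hx) |>.le⟩
  refine le_antisymm (monotone_cdf μ (csInf_le hbdd (le_refl (cdf μ y)))) ?_
  exact (isClosed_le continuous_const hc).csInf_mem ⟨y, le_refl (cdf μ y)⟩ hbdd

theorem quantile_mem_Icc {μ : Measure ℝ} [IsProbabilityMeasure μ] [NullSingletonClass μ]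
    {a b u : ℝ} (ha : cdf μ a = 0) (hb : cdf μ b = 1) (h0 : 0 < u) (h1 : u < 1) :
    quantile μ u ∈ Icc a b := by
  have hu := cdf_quantile μ h0 h1
  constructor <;> refine ((monotone_cdf μ).reflect_lt ?_).le <;> linarith

theorem cdf_eq_iff_eq_quantile {μ : Measure ℝ} [IsProbabilityMeasure μ] [NullSingletonClass μ]
    {s : Set ℝ} {u x : ℝ} (hs : InjOn (cdf μ) s) (h0 : 0 < u) (h1 : u < 1)
    (hu : quantile μ u ∈ s) (hx : x ∈ s) : cdf μ x = u ↔ x = quantile μ u := by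
  rw [← hs.eq_iff hx hu, cdf_quantile μ h0 h1]

/-! ### Binomial tails -/

/-- The density of the `Beta(X, n - X + 1)` distribution on `[0, 1]`, with its normalising
constant written as `n * (n - 1).choose (X - 1)`. -/
noncomputable def betaDensity (n X : ℕ) (p : ℝ) : ℝ :=
  n * (n - 1).choose (X - 1) * (p ^ (X - 1) * (1 - p) ^ (n - X))

theorem betaDensity_pos {n X : ℕ} {p : ℝ} (hX : 1 ≤ X) (hXn : X ≤ n) (hp : p ∈ Ioo 0 1) :
    0 < betaDensity n X p := by
  have hchoose : 0 < (n - 1).choose (X - 1) := Nat.choose_pos (by lia)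
  have hn : 0 < n := by lia
  have hp₀ : 0 < p := hp.1
  have hq : 0 < 1 - p := sub_pos.2 hp.2
  unfold betaDensity
  positivity

theorem betaDensity_nonneg (n X : ℕ) {p : ℝ} (hp : p ∈ Icc 0 1) : 0 ≤ betaDensity n X p := by
  have hp₀ : 0 ≤ p := hp.1
  have hq : 0 ≤ 1 - p := sub_nonneg.2 hp.2
  unfold betaDensity
  positivity

@[fun_prop]
theorem continuous_betaDensity (n X : ℕ) : Continuous (betaDensity n X) := by
  unfold betaDensity
  fun_prop

theorem derivative_sum_bernsteinPolynomial {m Y : ℕ} (hY : Y ≤ m) :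
    Polynomial.derivative (∑ k ∈ Finset.Icc (Y + 1) (m + 1), bernsteinPolynomial ℝ (m + 1) k)
      = ((m + 1 : ℕ) : Polynomial ℝ) * bernsteinPolynomial ℝ m Y := by
  have hIcc : Finset.Icc (Y + 1) (m + 1) = Finset.Ico (Y + 1) (m + 1 + 1) := by grind
  have htelescope : ∑ k ∈ Finset.Ico Y (m + 1),
      (bernsteinPolynomial ℝ m k - bernsteinPolynomial ℝ m (k + 1)) =
        bernsteinPolynomial ℝ m Y := by
    rw [← neg_inj, ← Finset.sum_neg_distrib]
    simp only [neg_sub]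
    rw [Finset.sum_Ico_sub (bernsteinPolynomial ℝ m) (by lia : Y ≤ m + 1),
      bernsteinPolynomial.eq_zero_of_lt ℝ m.lt_succ_self, zero_sub]
  rw [hIcc, ← Finset.sum_Ico_add' (bernsteinPolynomial ℝ (m + 1)) Y (m + 1) 1,
    Polynomial.derivative_sum]
  simp only [bernsteinPolynomial.derivative_succ, Nat.add_sub_cancel]
  rw [← Finset.mul_sum, htelescope]

theorem hasDerivAt_binomGE {n X : ℕ} (hX : 1 ≤ X) (hXn : X ≤ n) (p : ℝ) :
    HasDerivAt (binomGE n X) (betaDensity n X p) p := by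
  obtain ⟨Y, rfl⟩ : ∃ Y, X = Y + 1 := ⟨X - 1, by lia⟩
  obtain ⟨m, rfl⟩ : ∃ m, n = m + 1 := ⟨n - 1, by lia⟩
  have hbern : binomGE (m + 1) (Y + 1)
      = fun p => (∑ k ∈ Finset.Icc (Y + 1) (m + 1), bernsteinPolynomial ℝ (m + 1) k).eval p := by
    funext p
    simp [binomGE, Polynomial.eval_finsetSum, bernsteinPolynomial]
  rw [hbern]
  refine (Polynomial.hasDerivAt _ p).congr_deriv ?_
  rw [derivative_sum_bernsteinPolynomial (by lia)]
  simp [betaDensity, bernsteinPolynomial, mul_assoc]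

@[fun_prop]
theorem continuous_binomGE (n X : ℕ) : Continuous (binomGE n X) := by
  unfold binomGE
  fun_prop

theorem binomGE_zero (n : ℕ) {X : ℕ} (hX : 1 ≤ X) : binomGE n X 0 = 0 := by
  refine Finset.sum_eq_zero fun k hk => ?_
  have : k ≠ 0 := by grind
  simp [this]

theorem binomGE_one {n X : ℕ} (hXn : X ≤ n) : binomGE n X 1 = 1 := by
  unfold binomGE
  rw [Finset.sum_eq_single_of_mem n (by simpa using hXn) fun k hk hkn => ?_]
  · simp
  · have : n - k ≠ 0 := by grind
    simp [this]

theorem strictMonoOn_binomGE {n X : ℕ} (hX : 1 ≤ X) (hXn : X ≤ n) :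
    StrictMonoOn (binomGE n X) (Icc 0 1) := by
  refine strictMonoOn_of_deriv_pos (convex_Icc 0 1) (by fun_prop) fun p hp => ?_
  rw [(hasDerivAt_binomGE hX hXn p).deriv]
  exact betaDensity_pos hX hXn (interior_Icc (α := ℝ) ▸ hp)

theorem binomGE_mem_Icc {n X : ℕ} (hX : 1 ≤ X) (hXn : X ≤ n) {p : ℝ} (hp : p ∈ Icc 0 1) :
    binomGE n X p ∈ Icc 0 1 := by
  have hmono := (strictMonoOn_binomGE hX hXn).monotoneOn
  rw [← binomGE_zero n hX, ← binomGE_one hXn]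
  exact ⟨hmono (left_mem_Icc.2 zero_le_one) hp hp.1, hmono hp (right_mem_Icc.2 zero_le_one) hp.2⟩

theorem binomLE_add_binomGE {n X : ℕ} (hXn : X ≤ n) (p : ℝ) :
    binomLE n X p + binomGE n (X + 1) p = 1 := by
  have hIcc (l m : ℕ) : Finset.Icc l m = Finset.Ico l (m + 1) := by grind
  unfold binomLE binomGE
  rw [hIcc, hIcc, Finset.sum_Ico_consecutive _ (Nat.zero_le _) (by lia), ← Finset.range_eq_Ico]
  calc ∑ k ∈ Finset.range (n + 1), (n.choose k : ℝ) * p ^ k * (1 - p) ^ (n - k)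
      = (p + (1 - p)) ^ n := by
        rw [add_pow]
        exact Finset.sum_congr rfl fun k _ => by ring
    _ = 1 := by rw [add_sub_cancel, one_pow]

theorem binomLE_eq_binomGE_one_sub {n X : ℕ} (hXn : X ≤ n) (p : ℝ) :
    binomLE n X p = binomGE n (n - X) (1 - p) := by
  unfold binomLE binomGE
  refine Finset.sum_bij' (fun k _ => n - k) (fun k _ => n - k) (by grind) (by grind) (by grind)
    (by grind) fun k hk => ?_
  have hk : k ≤ n := by grind
  rw [Nat.choose_symm hk, Nat.sub_sub_self hk, sub_sub_cancel]
  ring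

/-! ### Beta distribution functions -/

instance {α β : ℝ} : NullSingletonClass (betaMeasure α β) := by
  unfold betaMeasure; infer_instance

theorem betaPDFReal_nonneg {α β : ℝ} (hα : 0 < α) (hβ : 0 < β) (x : ℝ) :
    0 ≤ betaPDFReal α β x := by
  by_cases hx : 0 < x ∧ x < 1
  · exact (betaPDFReal_pos hx.1 hx.2 hα hβ).le
  · rw [betaPDFReal, if_neg hx]

theorem cdf_betaMeasure_eq_integral {α β x : ℝ} (hα : 0 < α) (hβ : 0 < β) (hx : 0 ≤ x) :
    cdf (betaMeasure α β) x = ∫ t in 0..x, betaPDFReal α β t := by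
  have := isProbabilityMeasureBeta hα hβ
  have hIic : cdf (betaMeasure α β) x = ∫ t in Iic x, betaPDFReal α β t := by
    rw [cdf_eq_real, betaMeasure, measureReal_def, withDensity_apply _ measurableSet_Iic]
    exact (integral_eq_lintegral_of_nonneg_ae (ae_of_all _ (betaPDFReal_nonneg hα hβ))
      (by fun_prop)).symm
  rw [hIic, intervalIntegral.integral_of_le hx]
  refine setIntegral_eq_of_subset_of_forall_sdiff_eq_zero measurableSet_Iic
    Ioc_subset_Iic_self fun t ht => ?_
  exact if_neg fun h => ht.2 ⟨h.1, ht.1⟩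

theorem isProbabilityMeasure_betaMeasure_natCast {n X : ℕ} (hX : 1 ≤ X) (hXn : X ≤ n) :
    IsProbabilityMeasure (betaMeasure X (n - X + 1)) := by
  have hXn' : (X : ℝ) ≤ n := by exact_mod_cast hXn
  exact isProbabilityMeasureBeta (Nat.cast_pos.2 hX) (by linarith)

theorem betaPDFReal_eq_betaDensity {n X : ℕ} (hX : 1 ≤ X) (hXn : X ≤ n) {p : ℝ}
    (hp : p ∈ Ioo 0 1) : betaPDFReal X (n - X + 1) p = betaDensity n X p := by
  obtain ⟨Y, rfl⟩ : ∃ Y, X = Y + 1 := ⟨X - 1, by lia⟩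
  obtain ⟨k, rfl⟩ : ∃ k, n = Y + k + 1 := ⟨n - Y - 1, by lia⟩
  have hk : ((Y + k + 1 : ℕ) : ℝ) - (Y + 1 : ℕ) + 1 = k + 1 := by push_cast; ring
  have hchoose : ((Y + k).choose Y : ℝ) * Y.factorial * k.factorial = (Y + k).factorial := by
    exact_mod_cast Nat.choose_symm_add (a := Y) (b := k) ▸
      Nat.add_choose_mul_factorial_mul_factorial Y k
  have hbeta : (1 / beta (Y + 1 : ℕ) (k + 1) : ℝ) = (Y + k + 1 : ℕ) * (Y + k).choose Y := by
    rw [beta, Nat.cast_succ, show (Y : ℝ) + 1 + (k + 1) = (Y + k + 1 : ℕ) + 1 by push_cast; ring,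
      Real.Gamma_nat_eq_factorial, Real.Gamma_nat_eq_factorial, Real.Gamma_nat_eq_factorial,
      Nat.factorial_succ, Nat.cast_mul, ← hchoose]
    field_simp
  rw [betaPDFReal, if_pos ⟨hp.1, hp.2⟩, hk, hbeta, betaDensity]
  simp [mul_assoc, show Y + k + 1 - (Y + 1) = k by lia]

theorem cdf_betaMeasure_eq_binomGE {n X : ℕ} (hX : 1 ≤ X) (hXn : X ≤ n) {p : ℝ}
    (hp : p ∈ Icc 0 1) : cdf (betaMeasure X (n - X + 1)) p = binomGE n X p := by
  have hX' : (0 : ℝ) < X := by exact_mod_cast hX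
  have hXn' : (X : ℝ) ≤ n := by exact_mod_cast hXn
  calc cdf (betaMeasure X (n - X + 1)) p
      = ∫ t in 0..p, betaPDFReal X (n - X + 1) t :=
        cdf_betaMeasure_eq_integral hX' (by linarith) hp.1
    _ = ∫ t in 0..p, betaDensity n X t := by
        refine intervalIntegral.integral_congr_uIoo fun t ht => ?_
        rw [uIoo_of_le hp.1] at ht
        exact betaPDFReal_eq_betaDensity hX hXn ⟨ht.1, ht.2.trans_le hp.2⟩
    _ = binomGE n X p := by
        rw [intervalIntegral.integral_eq_sub_of_hasDerivAt
          (fun t _ => hasDerivAt_binomGE hX hXn t)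
          ((continuous_betaDensity n X).intervalIntegrable _ _), binomGE_zero n hX, sub_zero]

/-! ### The limits as solutions of the tail equations -/

section Limits

variable {a : ℝ} {n X : ℕ}

theorem lower_mem_Icc (ha0 : 0 < a) (ha1 : a < 1) (hX : 1 ≤ X) (hXn : X ≤ n) :
    lower a n X ∈ Icc 0 1 := by
  have := isProbabilityMeasure_betaMeasure_natCast hX hXn
  refine quantile_mem_Icc ?_ ?_ ha0 ha1
  · rw [cdf_betaMeasure_eq_binomGE hX hXn (left_mem_Icc.2 zero_le_one), binomGE_zero n hX]
  · rw [cdf_betaMeasure_eq_binomGE hX hXn (right_mem_Icc.2 zero_le_one), binomGE_one hXn]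

theorem binomGE_eq_iff_eq_lower (ha0 : 0 < a) (ha1 : a < 1) (hX : 1 ≤ X) (hXn : X ≤ n) {p : ℝ}
    (hp : p ∈ Icc 0 1) : binomGE n X p = a ↔ p = lower a n X := by
  have := isProbabilityMeasure_betaMeasure_natCast hX hXn
  have hcdf : EqOn (cdf (betaMeasure X (n - X + 1))) (binomGE n X) (Icc 0 1) :=
    fun _ => cdf_betaMeasure_eq_binomGE hX hXn
  rw [← hcdf hp]
  exact cdf_eq_iff_eq_quantile ((strictMonoOn_binomGE hX hXn).injOn.congr hcdf.symm) ha0 ha1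
    (lower_mem_Icc ha0 ha1 hX hXn) hp

theorem upper_eq_lower_succ (a : ℝ) (n X : ℕ) : upper a n X = lower (1 - a) n (X + 1) := by
  rw [upper, lower, Nat.cast_succ, sub_add_eq_sub_sub, sub_add_cancel]

theorem upper_mem_Icc (ha0 : 0 < a) (ha1 : a < 1) (hXn : X < n) : upper a n X ∈ Icc 0 1 := by
  rw [upper_eq_lower_succ]
  exact lower_mem_Icc (by linarith) (by linarith) (by lia) hXn

theorem binomLE_eq_iff_eq_upper (ha0 : 0 < a) (ha1 : a < 1) (hXn : X < n) {p : ℝ}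
    (hp : p ∈ Icc 0 1) : binomLE n X p = a ↔ p = upper a n X := by
  rw [upper_eq_lower_succ, ← binomGE_eq_iff_eq_lower (by linarith) (by linarith) (by lia) hXn hp,
    ← binomLE_add_binomGE hXn.le p]
  constructor <;> intro h <;> linarith

theorem upper_eq_one_sub_lower (ha0 : 0 < a) (ha1 : a < 1) (hXn : X < n) :
    upper a n X = 1 - lower a n (n - X) := by
  have hl := lower_mem_Icc ha0 ha1 (X := n - X) (by lia) (Nat.sub_le n X)
  have hmem : 1 - lower a n (n - X) ∈ Icc 0 1 := ⟨by linarith [hl.2], by linarith [hl.1]⟩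
  refine ((binomLE_eq_iff_eq_upper ha0 ha1 hXn hmem).1 ?_).symm
  rw [binomLE_eq_binomGE_one_sub hXn.le, sub_sub_cancel]
  exact (binomGE_eq_iff_eq_lower ha0 ha1 (by lia) (Nat.sub_le n X) hl).2 rfl

end Limits

/-! ### The approximate quantile -/

/-- The standard deviation of a Bernoulli variable with success probability `p`. -/
noncomputable def sd (p : ℝ) : ℝ := √(p * (1 - p))

/-- The coefficient of `n⁻¹` in the expansion of the lower limit, in units of `sd p`. -/
noncomputable def corr₁ (p z : ℝ) : ℝ := (2 * (1 / 2 - p) * z ^ 2 - (1 + p)) / (3 * sd p)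

/-- The derivative of `corr₁ p`. -/
noncomputable def corr₁Deriv (p z : ℝ) : ℝ := 4 * (1 / 2 - p) * z / (3 * sd p)

/-- The coefficient of `n ^ (-3/2)` in the expansion of the lower limit, in units of `sd p`. -/
noncomputable def corr₂ (p z : ℝ) : ℝ :=
  z * (53 / 36 + (1 / 2 - p) / p - (z ^ 2 + 11) / (36 * (p * (1 - p))) + 13 * z ^ 2 / 36)

/-- The derivative of `corr₂ p`. -/
noncomputable def corr₂Deriv (p z : ℝ) : ℝ :=
  53 / 36 + (1 / 2 - p) / p - (3 * z ^ 2 + 11) / (36 * (p * (1 - p))) + 13 * (3 * z ^ 2) / 36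

/-- The relative correction to the normal approximation, where `ε` stands for `n ^ (-1/2)`. -/
noncomputable def corr (ε p z : ℝ) : ℝ := corr₁ p z + ε * corr₂ p z

/-- The derivative of `corr ε p`. -/
noncomputable def corrDeriv (ε p z : ℝ) : ℝ := corr₁Deriv p z + ε * corr₂Deriv p z

/-- The expansion of the lower limit, centred at `p` and in units of `ε * sd p`, as a function of
the upper normal quantile `z`. -/
noncomputable def stdQuantile (ε p z : ℝ) : ℝ := -z + ε * corr ε p z

/-- The expansion of the lower limit through the term of order `n ^ (-3/2)`, with `ε` standing for
`n ^ (-1/2)`. -/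
noncomputable def approxQuantile (ε p z : ℝ) : ℝ := p + sd p * ε * stdQuantile ε p z

/-- The relative deviation of `approxQuantile ε p z` from `p`, divided by `ε`: the approximate
quantile is `p * (1 + ε * successShift ε p z)`. -/
noncomputable def successShift (ε p z : ℝ) : ℝ := sd p / p * stdQuantile ε p z

/-- The counterpart of `successShift` for the failure probability: the complement of
`approxQuantile ε p z` is `(1 - p) * (1 - ε * failureShift ε p z)`. -/
noncomputable def failureShift (ε p z : ℝ) : ℝ := sd p / (1 - p) * stdQuantile ε p z

theorem sd_sq {p : ℝ} (hp : p ∈ Ioo 0 1) : sd p ^ 2 = p * (1 - p) :=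
  Real.sq_sqrt (mul_pos hp.1 (sub_pos.2 hp.2)).le

theorem sd_pos {p : ℝ} (hp : p ∈ Ioo 0 1) : 0 < sd p :=
  Real.sqrt_pos.2 (mul_pos hp.1 (sub_pos.2 hp.2))

theorem sd_nonneg (p : ℝ) : 0 ≤ sd p := Real.sqrt_nonneg _

@[fun_prop]
theorem continuous_sd : Continuous sd := by
  unfold sd
  fun_prop

theorem approxQuantile_eq_mul {p : ℝ} (hp : p ≠ 0) (ε z : ℝ) :
    approxQuantile ε p z = p * (1 + ε * successShift ε p z) := by
  unfold approxQuantile successShift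
  field_simp

theorem one_sub_approxQuantile_eq_mul {p : ℝ} (hp : 1 - p ≠ 0) (ε z : ℝ) :
    1 - approxQuantile ε p z = (1 - p) * (1 - ε * failureShift ε p z) := by
  unfold approxQuantile failureShift
  field_simp
  ring

theorem hasDerivAt_corr (ε p z : ℝ) : HasDerivAt (corr ε p) (corrDeriv ε p z) z := by
  have hid := hasDerivAt_id z
  have h₁ : HasDerivAt (corr₁ p) (corr₁Deriv p z) z := by
    refine ((((hid.pow 2).const_mul (2 * (1 / 2 - p))).sub_const (1 + p)).div_const
      (3 * sd p)).congr_deriv ?_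
    simp only [corr₁Deriv, id]
    ring
  have h₂ : HasDerivAt (corr₂ p) (corr₂Deriv p z) z := by
    have hquad := ((hid.pow 2).add_const 11).div_const (36 * (p * (1 - p)))
    refine (hid.mul ((hquad.const_sub (53 / 36 + (1 / 2 - p) / p)).add
      (((hid.pow 2).const_mul 13).div_const 36))).congr_deriv ?_
    simp only [corr₂Deriv, id, Pi.add_apply, Pi.pow_apply]
    ring
  exact h₁.add (h₂.const_mul ε)

theorem hasDerivAt_approxQuantile (ε p z : ℝ) :
    HasDerivAt (approxQuantile ε p) (-(sd p * ε * (1 - ε * corrDeriv ε p z))) z :=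
  ((((hasDerivAt_id z).neg.add ((hasDerivAt_corr ε p z).const_mul ε)).const_mul
    (sd p * ε)).const_add p).congr_deriv (by ring)

/-! ### Polynomial growth, uniformly in parameters -/

/-- `f θ z` is bounded by a polynomial in `|z|`, uniformly over the parameters `θ ∈ S`. -/
def PolyGrowthOn {Θ : Type*} (S : Set Θ) (f : Θ → ℝ → ℝ) : Prop :=
  ∃ C : ℝ, 0 ≤ C ∧ ∃ k : ℕ, ∀ θ ∈ S, ∀ z, |f θ z| ≤ C * (1 + |z|) ^ k

namespace PolyGrowthOn

variable {Θ : Type*} {S : Set Θ} {f g : Θ → ℝ → ℝ}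

theorem add (hf : PolyGrowthOn S f) (hg : PolyGrowthOn S g) :
    PolyGrowthOn S (fun θ z => f θ z + g θ z) := by
  obtain ⟨C, hC, k, hf⟩ := hf
  obtain ⟨D, hD, l, hg⟩ := hg
  refine ⟨C + D, by positivity, max k l, fun θ hθ z => ?_⟩
  have hz : 1 ≤ 1 + |z| := le_add_of_nonneg_right (abs_nonneg z)
  calc |f θ z + g θ z| ≤ |f θ z| + |g θ z| := abs_add_le _ _
    _ ≤ C * (1 + |z|) ^ k + D * (1 + |z|) ^ l := add_le_add (hf θ hθ z) (hg θ hθ z)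
    _ ≤ C * (1 + |z|) ^ max k l + D * (1 + |z|) ^ max k l := by
      gcongr
      · exact le_max_left _ _
      · exact le_max_right _ _
    _ = (C + D) * (1 + |z|) ^ max k l := by ring

theorem mul (hf : PolyGrowthOn S f) (hg : PolyGrowthOn S g) :
    PolyGrowthOn S (fun θ z => f θ z * g θ z) := by
  obtain ⟨C, hC, k, hf⟩ := hf
  obtain ⟨D, hD, l, hg⟩ := hg
  refine ⟨C * D, by positivity, k + l, fun θ hθ z => ?_⟩
  calc |f θ z * g θ z| = |f θ z| * |g θ z| := abs_mul _ _
    _ ≤ (C * (1 + |z|) ^ k) * (D * (1 + |z|) ^ l) :=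
      mul_le_mul (hf θ hθ z) (hg θ hθ z) (abs_nonneg _) (by positivity)
    _ = C * D * (1 + |z|) ^ (k + l) := by ring

theorem neg (hf : PolyGrowthOn S f) : PolyGrowthOn S (fun θ z => -f θ z) := by
  simpa only [PolyGrowthOn, abs_neg] using hf

theorem sub (hf : PolyGrowthOn S f) (hg : PolyGrowthOn S g) :
    PolyGrowthOn S (fun θ z => f θ z - g θ z) := by
  simpa only [sub_eq_add_neg] using hf.add hg.neg

theorem abs (hf : PolyGrowthOn S f) : PolyGrowthOn S (fun θ z => |f θ z|) := by
  simpa only [PolyGrowthOn, abs_abs] using hf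

theorem const (c : ℝ) : PolyGrowthOn S (fun _ _ => c) :=
  ⟨|c|, abs_nonneg c, 0, fun _ _ _ => by simp⟩

theorem pow (hf : PolyGrowthOn S f) (m : ℕ) : PolyGrowthOn S (fun θ z => f θ z ^ m) := by
  induction m with
  | zero => simpa only [pow_zero] using const 1
  | succ m ih => simpa only [pow_succ] using ih.mul hf

theorem var : PolyGrowthOn S (fun _ z => z) :=
  ⟨1, zero_le_one, 1, fun _ _ z => by linarith⟩

theorem param [TopologicalSpace Θ] (hS : IsCompact S) {h : Θ → ℝ} (hh : ContinuousOn h S) :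
    PolyGrowthOn S (fun θ _ => h θ) := by
  obtain ⟨C, hC⟩ := hS.exists_bound_of_continuousOn hh
  refine ⟨max C 0, le_max_right _ _, 0, fun θ hθ z => ?_⟩
  rw [pow_zero, mul_one]
  exact (hC θ hθ).trans (le_max_left _ _)

end PolyGrowthOn

/-- The domain of the pairs `(ε, p)` over which all estimates are uniform. -/
def paramSet (δ : ℝ) : Set (ℝ × ℝ) := Icc 0 1 ×ˢ Icc δ (1 - δ)

section PolyGrowth

variable {δ : ℝ}

theorem mem_Ioo_of_mem_Icc {p : ℝ} (hδ : 0 < δ) (hp : p ∈ Icc δ (1 - δ)) : p ∈ Ioo 0 1 :=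
  ⟨hδ.trans_le hp.1, by linarith [hp.2]⟩

theorem polyGrowthOn_param {h : ℝ × ℝ → ℝ} (hh : ContinuousOn h (paramSet δ)) :
    PolyGrowthOn (paramSet δ) (fun θ _ => h θ) :=
  .param (isCompact_Icc.prod isCompact_Icc) hh

theorem polyGrowthOn_fst : PolyGrowthOn (paramSet δ) (fun θ _ => θ.1) :=
  polyGrowthOn_param continuousOn_fst

theorem polyGrowthOn_snd : PolyGrowthOn (paramSet δ) (fun θ _ => θ.2) :=
  polyGrowthOn_param continuousOn_snd

theorem polyGrowthOn_sd : PolyGrowthOn (paramSet δ) (fun θ _ => sd θ.2) :=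
  polyGrowthOn_param (by fun_prop)

theorem polyGrowthOn_inv_sd (hδ : 0 < δ) : PolyGrowthOn (paramSet δ) (fun θ _ => (sd θ.2)⁻¹) :=
  polyGrowthOn_param <| ContinuousOn.inv₀ (by fun_prop) fun _ hθ =>
    (sd_pos (mem_Ioo_of_mem_Icc hδ hθ.2)).ne'

theorem polyGrowthOn_inv (hδ : 0 < δ) : PolyGrowthOn (paramSet δ) (fun θ _ => θ.2⁻¹) :=
  polyGrowthOn_param <| continuousOn_snd.inv₀ fun _ hθ => (mem_Ioo_of_mem_Icc hδ hθ.2).1.ne'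

theorem polyGrowthOn_inv_one_sub (hδ : 0 < δ) :
    PolyGrowthOn (paramSet δ) (fun θ _ => (1 - θ.2)⁻¹) :=
  polyGrowthOn_param <| ContinuousOn.inv₀ (by fun_prop) fun _ hθ =>
    (sub_pos.2 (mem_Ioo_of_mem_Icc hδ hθ.2).2).ne'

theorem polyGrowthOn_corr₁ (hδ : 0 < δ) : PolyGrowthOn (paramSet δ) (fun θ => corr₁ θ.2) := by
  simp only [PolyGrowthOn, corr₁, div_eq_mul_inv, mul_inv]
  apply_rules [PolyGrowthOn.sub, PolyGrowthOn.add, PolyGrowthOn.mul, PolyGrowthOn.pow,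
    PolyGrowthOn.const, PolyGrowthOn.var, polyGrowthOn_snd, polyGrowthOn_inv_sd]

theorem polyGrowthOn_corr₁Deriv (hδ : 0 < δ) :
    PolyGrowthOn (paramSet δ) (fun θ => corr₁Deriv θ.2) := by
  simp only [PolyGrowthOn, corr₁Deriv, div_eq_mul_inv, mul_inv]
  apply_rules [PolyGrowthOn.sub, PolyGrowthOn.mul, PolyGrowthOn.const, PolyGrowthOn.var,
    polyGrowthOn_snd, polyGrowthOn_inv_sd]

theorem polyGrowthOn_corr₂ (hδ : 0 < δ) : PolyGrowthOn (paramSet δ) (fun θ => corr₂ θ.2) := by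
  simp only [PolyGrowthOn, corr₂, div_eq_mul_inv, mul_inv]
  apply_rules [PolyGrowthOn.sub, PolyGrowthOn.add, PolyGrowthOn.mul, PolyGrowthOn.pow,
    PolyGrowthOn.const, PolyGrowthOn.var, polyGrowthOn_snd, polyGrowthOn_inv,
    polyGrowthOn_inv_one_sub]

theorem polyGrowthOn_corr₂Deriv (hδ : 0 < δ) :
    PolyGrowthOn (paramSet δ) (fun θ => corr₂Deriv θ.2) := by
  simp only [PolyGrowthOn, corr₂Deriv, div_eq_mul_inv, mul_inv]
  apply_rules [PolyGrowthOn.sub, PolyGrowthOn.add, PolyGrowthOn.mul, PolyGrowthOn.pow,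
    PolyGrowthOn.const, PolyGrowthOn.var, polyGrowthOn_snd, polyGrowthOn_inv,
    polyGrowthOn_inv_one_sub]

theorem polyGrowthOn_corr (hδ : 0 < δ) :
    PolyGrowthOn (paramSet δ) (fun θ => corr θ.1 θ.2) :=
  (polyGrowthOn_corr₁ hδ).add (polyGrowthOn_fst.mul (polyGrowthOn_corr₂ hδ))

theorem polyGrowthOn_corrDeriv (hδ : 0 < δ) :
    PolyGrowthOn (paramSet δ) (fun θ => corrDeriv θ.1 θ.2) :=
  (polyGrowthOn_corr₁Deriv hδ).add (polyGrowthOn_fst.mul (polyGrowthOn_corr₂Deriv hδ))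

theorem polyGrowthOn_stdQuantile (hδ : 0 < δ) :
    PolyGrowthOn (paramSet δ) (fun θ => stdQuantile θ.1 θ.2) :=
  PolyGrowthOn.var.neg.add (polyGrowthOn_fst.mul (polyGrowthOn_corr hδ))

theorem polyGrowthOn_successShift (hδ : 0 < δ) :
    PolyGrowthOn (paramSet δ) (fun θ => successShift θ.1 θ.2) :=
  (polyGrowthOn_sd.mul (polyGrowthOn_inv hδ)).mul (polyGrowthOn_stdQuantile hδ)

theorem polyGrowthOn_failureShift (hδ : 0 < δ) :
    PolyGrowthOn (paramSet δ) (fun θ => failureShift θ.1 θ.2) :=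
  (polyGrowthOn_sd.mul (polyGrowthOn_inv_one_sub hδ)).mul (polyGrowthOn_stdQuantile hδ)

end PolyGrowth

/-! ### Expansion of the logarithm of the density ratio -/

/-- The Taylor polynomial of degree `m` of `log (1 + t)` at `t = 0`. -/
noncomputable def logTaylor (m : ℕ) (t : ℝ) : ℝ :=
  ∑ i ∈ Finset.range m, (-1) ^ i * t ^ (i + 1) / (i + 1)

theorem abs_log_one_add_sub_logTaylor_le (m : ℕ) {t : ℝ} (ht : |t| ≤ 1 / 2) :
    |Real.log (1 + t) - logTaylor m t| ≤ 2 * |t| ^ (m + 1) := by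
  have hlog := Real.abs_log_sub_add_sum_range_le (x := -t) (by rw [abs_neg]; linarith) m
  have hsum : ∑ i ∈ Finset.range m, (-t) ^ (i + 1) / (i + 1) = -logTaylor m t := by
    rw [logTaylor, ← Finset.sum_neg_distrib]
    refine Finset.sum_congr rfl fun i _ => ?_
    rw [neg_pow t, pow_succ (-1 : ℝ)]
    ring
  rw [hsum, abs_neg, sub_neg_eq_add, neg_add_eq_sub] at hlog
  refine hlog.trans ?_
  rw [div_le_iff₀ (by linarith)]
  nlinarith [pow_nonneg (abs_nonneg t) (m + 1)]

theorem abs_log_one_add_mul_sub_logTaylor_le (m : ℕ) {ε t : ℝ} (hε : 0 ≤ ε)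
    (ht : |ε * t| ≤ 1 / 2) :
    |Real.log (1 + ε * t) - logTaylor m (ε * t)| ≤ 2 * (ε ^ (m + 1) * |t| ^ (m + 1)) := by
  rw [← mul_pow, ← abs_of_nonneg hε, ← abs_mul, abs_of_nonneg hε]
  exact abs_log_one_add_sub_logTaylor_le m ht

theorem abs_log_one_sub_mul_sub_logTaylor_le (m : ℕ) {ε t : ℝ} (hε : 0 ≤ ε)
    (ht : |ε * t| ≤ 1 / 2) :
    |Real.log (1 - ε * t) - logTaylor m (-(ε * t))| ≤ 2 * (ε ^ (m + 1) * |t| ^ (m + 1)) := by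
  simpa [← sub_eq_add_neg] using
    abs_log_one_add_mul_sub_logTaylor_le m (t := -t) hε (by rwa [mul_neg, abs_neg])

/-- The coefficient of `ε * y ^ 3` in the expansion of `-H / ε ^ 2`, where `H` is the entropy of the
Bernoulli distribution with parameter `p` relative to the one with parameter `p + ε * sd p * y`. -/
noncomputable def cubicCoeff (p : ℝ) : ℝ := (1 - 2 * p) / (3 * sd p)

/-- The coefficient of `-ε ^ 2 * y ^ 4` in the same expansion as `cubicCoeff`. -/
noncomputable def quarticCoeff (p : ℝ) : ℝ := (1 - 3 * (p * (1 - p))) / (4 * (p * (1 - p)))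

/-- The correction of order `ε ^ 2` to the normalising constant, fixed by `corr_second_order`. -/
noncomputable def normCorr (p : ℝ) : ℝ :=
  -(1 + p) ^ 2 / (18 * (p * (1 - p))) + (1 + p) / (3 * p)
    - (53 / 36 + (1 / 2 - p) / p - 11 / (36 * (p * (1 - p))))

/-- The logarithm of the ratio between the beta density transported by `approxQuantile ε p` and
the standard normal density, up to a factor that does not depend on `z`. -/
noncomputable def logRatio (ε p z : ℝ) : ℝ :=
  (p * Real.log (1 + ε * successShift ε p z)
      + (1 - p) * Real.log (1 - ε * failureShift ε p z)) / ε ^ 2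
    - Real.log (1 + ε * successShift ε p z) + Real.log (1 - ε * corrDeriv ε p z)
    + z ^ 2 / 2 - ε ^ 2 * normCorr p

/-- `logRatio` with each logarithm replaced by the Taylor polynomial that matters up to
order `ε ^ 2`. -/
noncomputable def truncLogRatio (ε p z : ℝ) : ℝ :=
  (p * logTaylor 4 (ε * successShift ε p z)
      + (1 - p) * logTaylor 4 (-(ε * failureShift ε p z))) / ε ^ 2
    - logTaylor 2 (ε * successShift ε p z) + logTaylor 2 (-(ε * corrDeriv ε p z))
    + z ^ 2 / 2 - ε ^ 2 * normCorr p

theorem corr_first_order {p : ℝ} (hp : p ∈ Ioo 0 1) (z : ℝ) :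
    z * corr₁ p z - cubicCoeff p * z ^ 3 + sd p / p * z - corr₁Deriv p z = 0 := by
  have hs := sd_pos hp
  have hratio : sd p / p = (1 - p) / sd p := by
    rw [div_eq_div_iff hp.1.ne' hs.ne', ← pow_two, sd_sq hp]
    ring
  rw [hratio, corr₁, corr₁Deriv, cubicCoeff]
  field_simp
  ring

theorem corr_second_order {p : ℝ} (hp : p ∈ Ioo 0 1) (z : ℝ) :
    z * corr₂ p z - corr₁ p z ^ 2 / 2 + cubicCoeff p * (3 * z ^ 2 * corr₁ p z)
      - quarticCoeff p * z ^ 4 - sd p / p * corr₁ p z + (sd p / p) ^ 2 / 2 * z ^ 2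
      - corr₂Deriv p z - corr₁Deriv p z ^ 2 / 2 - normCorr p = 0 := by
  have hp₀ : 0 < p := hp.1
  have hq : 0 < 1 - p := sub_pos.2 hp.2
  have hs := sd_pos hp
  have hsq : sd p ^ 2 = p * (1 - p) := sd_sq hp
  have hcubic : cubicCoeff p * corr₁ p z
      = (1 - 2 * p) * (2 * (1 / 2 - p) * z ^ 2 - (1 + p)) / (9 * (p * (1 - p))) := by
    rw [← hsq, cubicCoeff, corr₁]; field_simp; ring
  have hcorr : corr₁ p z ^ 2
      = (2 * (1 / 2 - p) * z ^ 2 - (1 + p)) ^ 2 / (9 * (p * (1 - p))) := by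
    rw [← hsq, corr₁]; field_simp; ring
  have hderiv : corr₁Deriv p z ^ 2 = (4 * (1 / 2 - p) * z) ^ 2 / (9 * (p * (1 - p))) := by
    rw [← hsq, corr₁Deriv]; field_simp; ring
  have hshift : sd p / p * corr₁ p z = (2 * (1 / 2 - p) * z ^ 2 - (1 + p)) / (3 * p) := by
    rw [corr₁]; field_simp
  have hratio : (sd p / p) ^ 2 = (1 - p) / p := by
    rw [div_pow, hsq]; field_simp
  have hassoc : cubicCoeff p * (3 * z ^ 2 * corr₁ p z) =
      3 * z ^ 2 * (cubicCoeff p * corr₁ p z) := by ring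
  rw [hassoc, hcubic, hcorr, hderiv, hshift, hratio, corr₂, corr₂Deriv, quarticCoeff, normCorr]
  field_simp
  ring

theorem logTaylor_entropy {ε p : ℝ} (hε : ε ≠ 0) (hp : p ∈ Ioo 0 1) (z : ℝ) :
    (p * logTaylor 4 (ε * successShift ε p z)
        + (1 - p) * logTaylor 4 (-(ε * failureShift ε p z))) / ε ^ 2
      = -(stdQuantile ε p z ^ 2 / 2) + ε * cubicCoeff p * stdQuantile ε p z ^ 3
        - ε ^ 2 * quarticCoeff p * stdQuantile ε p z ^ 4 := by
  have hp₀ : 0 < p := hp.1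
  have hq : 0 < 1 - p := sub_pos.2 hp.2
  have hs := sd_pos hp
  have hsq : sd p ^ 2 = p * (1 - p) := sd_sq hp
  have hcubic : cubicCoeff p = sd p ^ 3 * (1 / p ^ 2 - 1 / (1 - p) ^ 2) / 3 := by
    rw [cubicCoeff, eq_div_iff three_ne_zero, div_mul_eq_mul_div, div_eq_iff (by positivity)]
    have hs4 : sd p ^ 3 * (3 * sd p) = 3 * (p * (1 - p)) ^ 2 := by rw [← hsq]; ring
    rw [mul_right_comm (sd p ^ 3), hs4]
    field_simp
    ring
  have hquartic : quarticCoeff p = sd p ^ 4 * (1 / p ^ 3 + 1 / (1 - p) ^ 3) / 4 := by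
    rw [quarticCoeff, show sd p ^ 4 = (sd p ^ 2) ^ 2 by ring, hsq]
    field_simp
    ring
  have hquadratic : stdQuantile ε p z ^ 2 / 2
      = sd p ^ 2 * (1 / p + 1 / (1 - p)) * stdQuantile ε p z ^ 2 / 2 := by
    rw [hsq]
    field_simp
    ring
  rw [hcubic, hquartic, hquadratic]
  simp only [logTaylor, Finset.sum_range_succ, Finset.sum_range_zero, successShift, failureShift]
  push_cast
  field_simp
  ring

/-- The cofactor of `ε ^ 3` in `truncLogRatio`, a polynomial in `ε` and `z`. -/
noncomputable def polyRemainder (ε p z : ℝ) : ℝ :=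
  -(corr₁ p z * corr₂ p z) - ε * corr₂ p z ^ 2 / 2
    + cubicCoeff p * (3 * z ^ 2 * corr₂ p z - 3 * z * corr ε p z ^ 2 + ε * corr ε p z ^ 3)
    - quarticCoeff p * (-(4 * z ^ 3 * corr ε p z) + 6 * z ^ 2 * ε * corr ε p z ^ 2
      - 4 * z * ε ^ 2 * corr ε p z ^ 3 + ε ^ 3 * corr ε p z ^ 4)
    - sd p / p * corr₂ p z + (sd p / p) ^ 2 / 2 * (-(2 * z * corr ε p z) + ε * corr ε p z ^ 2)
    - (2 * corr₁Deriv p z * corr₂Deriv p z + ε * corr₂Deriv p z ^ 2) / 2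

theorem truncLogRatio_eq {ε p : ℝ} (hε : ε ≠ 0) (hp : p ∈ Ioo 0 1) (z : ℝ) :
    truncLogRatio ε p z = ε ^ 3 * polyRemainder ε p z := by
  rw [truncLogRatio, logTaylor_entropy hε hp]
  simp only [logTaylor, Finset.sum_range_succ, Finset.sum_range_zero, successShift, polyRemainder,
    corrDeriv, stdQuantile, corr]
  push_cast
  linear_combination ε * corr_first_order hp z + ε ^ 2 * corr_second_order hp z

theorem polyGrowthOn_polyRemainder {δ : ℝ} (hδ : 0 < δ) :
    PolyGrowthOn (paramSet δ) (fun θ => polyRemainder θ.1 θ.2) := by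
  have hcorr₁ := polyGrowthOn_corr₁ hδ
  have hcorr₂ := polyGrowthOn_corr₂ hδ
  have hderiv₁ := polyGrowthOn_corr₁Deriv hδ
  have hderiv₂ := polyGrowthOn_corr₂Deriv hδ
  have hcorr := polyGrowthOn_corr hδ
  have hsd := polyGrowthOn_sd (δ := δ)
  have hinv_sd := polyGrowthOn_inv_sd hδ
  have hinv := polyGrowthOn_inv hδ
  have hinv' := polyGrowthOn_inv_one_sub hδ
  simp only [PolyGrowthOn, polyRemainder, cubicCoeff, quarticCoeff, div_eq_mul_inv, mul_inv]
  refine PolyGrowthOn.sub (.add (.sub (.sub (.add (.sub ?_ ?_) ?_) ?_) ?_) ?_) ?_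
  all_goals
    apply_rules [PolyGrowthOn.pow, PolyGrowthOn.sub, PolyGrowthOn.add, PolyGrowthOn.neg,
      PolyGrowthOn.mul, PolyGrowthOn.const, PolyGrowthOn.var, polyGrowthOn_fst, polyGrowthOn_snd]

/-- `z` is small enough, relative to `1 / ε`, for the expansions of the logarithms in `logRatio`
to converge. -/
structure IsRegularAt (ε p z : ℝ) : Prop where
  success : |ε * successShift ε p z| ≤ 1 / 2
  failure : |ε * failureShift ε p z| ≤ 1 / 2
  deriv : |ε * corrDeriv ε p z| ≤ 1 / 2

theorem abs_logRatio_sub_truncLogRatio_le {ε p z : ℝ} (hε : 0 < ε) (hp : p ∈ Icc 0 1)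
    (h : IsRegularAt ε p z) :
    |logRatio ε p z - truncLogRatio ε p z|
      ≤ ε ^ 3 * (2 * |successShift ε p z| ^ 5 + 2 * |failureShift ε p z| ^ 5
        + 2 * |successShift ε p z| ^ 3 + 2 * |corrDeriv ε p z| ^ 3) := by
  set u := successShift ε p z
  set v := failureShift ε p z
  set w := corrDeriv ε p z
  have hu₄ := abs_log_one_add_mul_sub_logTaylor_le 4 hε.le h.success
  have hu₂ := abs_log_one_add_mul_sub_logTaylor_le 2 hε.le h.success
  have hv₄ := abs_log_one_sub_mul_sub_logTaylor_le 4 hε.le h.failure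
  have hw₂ := abs_log_one_sub_mul_sub_logTaylor_le 2 hε.le h.deriv
  have hentropy : |p * (Real.log (1 + ε * u) - logTaylor 4 (ε * u))
      + (1 - p) * (Real.log (1 - ε * v) - logTaylor 4 (-(ε * v)))|
      ≤ 2 * (ε ^ 5 * |u| ^ 5) + 2 * (ε ^ 5 * |v| ^ 5) := by
    refine (abs_add_le _ _).trans (add_le_add ?_ ?_) <;> rw [abs_mul]
    · rw [abs_of_nonneg hp.1]
      exact (mul_le_of_le_one_left (abs_nonneg _) hp.2).trans hu₄
    · rw [abs_of_nonneg (sub_nonneg.2 hp.2)]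
      exact (mul_le_of_le_one_left (abs_nonneg _) (sub_le_self 1 hp.1)).trans hv₄
  calc |logRatio ε p z - truncLogRatio ε p z|
      = |(p * (Real.log (1 + ε * u) - logTaylor 4 (ε * u))
          + (1 - p) * (Real.log (1 - ε * v) - logTaylor 4 (-(ε * v)))) / ε ^ 2
        - (Real.log (1 + ε * u) - logTaylor 2 (ε * u))
        + (Real.log (1 - ε * w) - logTaylor 2 (-(ε * w)))| := by
        rw [logRatio, truncLogRatio]
        congr 1
        ring
    _ ≤ (2 * (ε ^ 5 * |u| ^ 5) + 2 * (ε ^ 5 * |v| ^ 5)) / ε ^ 2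
        + 2 * (ε ^ 3 * |u| ^ 3) + 2 * (ε ^ 3 * |w| ^ 3) := by
        refine (abs_add_le _ _).trans (add_le_add ((abs_sub _ _).trans (add_le_add ?_ hu₂)) hw₂)
        rw [abs_div, abs_of_pos (pow_pos hε 2)]
        gcongr
    _ = _ := by
        field_simp

theorem exists_abs_logRatio_le {δ : ℝ} (hδ : 0 < δ) :
    ∃ C : ℝ, 0 ≤ C ∧ ∃ k : ℕ, ∀ ε p z : ℝ, 0 < ε → (ε, p) ∈ paramSet δ → IsRegularAt ε p z →
      |logRatio ε p z| ≤ ε ^ 3 * (C * (1 + |z|) ^ k) := by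
  have hgrowth : PolyGrowthOn (paramSet δ) fun θ z => |polyRemainder θ.1 θ.2 z|
      + (2 * |successShift θ.1 θ.2 z| ^ 5 + 2 * |failureShift θ.1 θ.2 z| ^ 5
        + 2 * |successShift θ.1 θ.2 z| ^ 3 + 2 * |corrDeriv θ.1 θ.2 z| ^ 3) := by
    have hrem := polyGrowthOn_polyRemainder hδ
    have hsuccess := polyGrowthOn_successShift hδ
    have hfailure := polyGrowthOn_failureShift hδ
    have hderiv := polyGrowthOn_corrDeriv hδ
    apply_rules [PolyGrowthOn.pow, PolyGrowthOn.add, PolyGrowthOn.mul, PolyGrowthOn.abs,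
      PolyGrowthOn.const]
  obtain ⟨C, hC, k, hgrowth⟩ := hgrowth
  refine ⟨C, hC, k, fun ε p z hε hθ h => ?_⟩
  have hp := mem_Ioo_of_mem_Icc hδ hθ.2
  have htrunc : |truncLogRatio ε p z| = ε ^ 3 * |polyRemainder ε p z| := by
    rw [truncLogRatio_eq hε.ne' hp, abs_mul, abs_of_pos (pow_pos hε 3)]
  calc |logRatio ε p z|
      ≤ |truncLogRatio ε p z| + |logRatio ε p z - truncLogRatio ε p z| := by
        simpa using abs_add_le (truncLogRatio ε p z) (logRatio ε p z - truncLogRatio ε p z)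
    _ ≤ _ := add_le_add htrunc.le
        (abs_logRatio_sub_truncLogRatio_le hε (Ioo_subset_Icc_self hp) h)
    _ ≤ ε ^ 3 * (C * (1 + |z|) ^ k) := by
        rw [← mul_add]
        exact mul_le_mul_of_nonneg_left ((le_abs_self _).trans (hgrowth _ hθ z)) (by positivity)

/-! ### The normal distribution -/

section Gaussian

variable (μ : ℝ) {v : NNReal}

@[fun_prop]
theorem continuous_gaussianPDFReal (v : NNReal) : Continuous (gaussianPDFReal μ v) := by
  unfold gaussianPDFReal
  fun_prop

theorem integral_gaussianPDFReal_eq_cdf_sub (hv : v ≠ 0) (a b : ℝ) :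
    ∫ t in a..b, gaussianPDFReal μ v t
      = cdf (gaussianReal μ v) b - cdf (gaussianReal μ v) a := by
  have hint := integrable_gaussianPDFReal μ v
  have hcdf (x : ℝ) : cdf (gaussianReal μ v) x = ∫ t in Iic x, gaussianPDFReal μ v t := by
    rw [cdf_eq_real, measureReal_def, gaussianReal_apply_eq_integral μ hv,
      ENNReal.toReal_ofReal (integral_nonneg (gaussianPDFReal_nonneg μ v))]
  rw [hcdf, hcdf, intervalIntegral.integral_Iic_sub_Iic hint.integrableOn hint.integrableOn]

theorem hasDerivAt_cdf_gaussianReal (hv : v ≠ 0) (x : ℝ) :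
    HasDerivAt (cdf (gaussianReal μ v)) (gaussianPDFReal μ v x) x := by
  have hcdf : (cdf (gaussianReal μ v) : ℝ → ℝ)
      = fun y => cdf (gaussianReal μ v) 0 + ∫ t in 0..y, gaussianPDFReal μ v t := by
    funext y
    rw [integral_gaussianPDFReal_eq_cdf_sub μ hv, add_sub_cancel]
  rw [hcdf]
  exact ((continuous_gaussianPDFReal μ v).integral_hasStrictDerivAt 0 x).hasDerivAt.const_add _

theorem integrable_gaussianPDFReal_mul_one_add_abs_pow (hv : v ≠ 0) (k : ℕ) :
    Integrable fun z : ℝ => gaussianPDFReal μ v z * (1 + |z|) ^ k := by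
  have hmoment : Integrable (fun z : ℝ => (1 + |z|) ^ k) (gaussianReal μ v) := by
    have habs : MemLp (fun z : ℝ => ‖z‖) k (gaussianReal μ v) :=
      (memLp_id_gaussianReal' k (ENNReal.natCast_ne_top k)).norm
    have hmemLp : MemLp (fun z : ℝ => 1 + |z|) k (gaussianReal μ v) :=
      MemLp.add (memLp_const (1 : ℝ)) habs
    refine hmemLp.integrable_norm_pow'.congr (ae_of_all _ fun z => ?_)
    dsimp only
    rw [Real.norm_of_nonneg (by positivity)]
  rw [gaussianReal_of_var_ne_zero μ hv, integrable_withDensity_iff_integrable_smul'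
    (measurable_gaussianPDF _ _) (ae_of_all _ fun _ => gaussianPDF_lt_top)] at hmoment
  simpa only [toReal_gaussianPDF, smul_eq_mul] using hmoment

theorem exists_mul_sub_le_cdf_gaussianReal_sub (hv : v ≠ 0) (x y : ℝ) :
    ∃ c : ℝ, 0 < c ∧ ∀ s ∈ Icc x y, ∀ t ∈ Icc x y, s ≤ t →
      c * (t - s) ≤ cdf (gaussianReal μ v) t - cdf (gaussianReal μ v) s := by
  rcases (Icc x y).eq_empty_or_nonempty with hempty | hne
  · exact ⟨1, one_pos, by simp [hempty]⟩
  obtain ⟨m, -, hm⟩ := isCompact_Icc.exists_isMinOn hne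
    (continuous_gaussianPDFReal μ v).continuousOn
  have hderiv := hasDerivAt_cdf_gaussianReal μ hv
  refine ⟨gaussianPDFReal μ v m, gaussianPDFReal_pos μ v m hv, fun s hs t ht hst => ?_⟩
  refine (convex_Icc x y).mul_sub_le_image_sub_of_le_deriv
    (fun r _ => (hderiv r).continuousAt.continuousWithinAt)
    (fun r _ => (hderiv r).differentiableAt.differentiableWithinAt)
    (fun r hr => ?_) s hs t ht hst
  rw [(hderiv r).deriv]
  exact hm (interior_subset hr)

end Gaussian

local notation "φ" => gaussianPDFReal 0 1

local notation "Φ" => cdf (gaussianReal 0 1)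

theorem gaussianPDFReal_zero_one_le (z : ℝ) : φ z ≤ Real.exp (-z ^ 2 / 2) := by
  rw [gaussianPDFReal]
  simp only [NNReal.coe_one, mul_one, sub_zero]
  refine mul_le_of_le_one_left (Real.exp_pos _).le (inv_le_one_of_one_le₀ ?_)
  rw [Real.one_le_sqrt]
  linarith [Real.pi_gt_three]

theorem hasSubgaussianMGF_id_gaussianReal_zero (v : NNReal) :
    HasSubgaussianMGF id v (gaussianReal 0 v) where
  integrable_exp_mul := integrable_exp_mul_gaussianReal
  mgf_le t := by simp only [mgf_id_gaussianReal, zero_mul, zero_add, le_refl]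

theorem cdf_gaussianReal_neg_le {M : ℝ} (hM : 0 ≤ M) : Φ (-M) ≤ Real.exp (-M ^ 2 / 2) := by
  rw [cdf_eq_real]
  simpa [le_neg, Iic] using (hasSubgaussianMGF_id_gaussianReal_zero 1).neg.measure_ge_le hM

theorem one_sub_cdf_gaussianReal_le {M : ℝ} (hM : 0 ≤ M) :
    1 - Φ M ≤ Real.exp (-M ^ 2 / 2) := by
  rw [cdf_eq_real, ← probReal_compl_eq_one_sub measurableSet_Iic, compl_Iic]
  refine (measureReal_mono Ioi_subset_Ici_self).trans ?_
  simpa [Ici] using (hasSubgaussianMGF_id_gaussianReal_zero 1).measure_ge_le hM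

theorem cdf_zUpper {a : ℝ} (ha0 : 0 < a) (ha1 : a < 1) : Φ (zUpper a) = 1 - a := by
  have := nullSingletonClass_gaussianReal (μ := 0) (one_ne_zero (α := NNReal))
  exact cdf_quantile _ (by linarith) (by linarith)

/-! ### The cutoff -/

/-- The bound up to which `z` is allowed to grow as `ε` tends to `0`, chosen so that
`exp (-cutoff ε ^ 2 / 2) = ε ^ 4`. -/
noncomputable def cutoff (ε : ℝ) : ℝ := √(-(8 * Real.log ε))

theorem cutoff_nonneg (ε : ℝ) : 0 ≤ cutoff ε := Real.sqrt_nonneg _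

theorem cutoff_sq {ε : ℝ} (hε : ε ∈ Ioc 0 1) : cutoff ε ^ 2 = -(8 * Real.log ε) :=
  Real.sq_sqrt (by linarith [Real.log_nonpos hε.1.le hε.2])

theorem exp_neg_cutoff_sq {ε : ℝ} (hε : ε ∈ Ioc 0 1) :
    Real.exp (-cutoff ε ^ 2 / 2) = ε ^ 4 := by
  rw [cutoff_sq hε, ← Real.exp_log (pow_pos hε.1 4), Real.log_pow]
  congr 1
  push_cast
  ring

theorem tendsto_cutoff : Tendsto cutoff (𝓝[>] 0) atTop :=
  Real.tendsto_sqrt_atTop.comp <| tendsto_neg_atBot_atTop.comp <|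
    Real.tendsto_log_nhdsGT_zero.const_mul_atBot (by norm_num)

theorem tendsto_mul_cutoff_pow (k : ℕ) :
    Tendsto (fun ε => ε * (1 + cutoff ε) ^ k) (𝓝[>] 0) (𝓝 0) := by
  have hexp : Tendsto (fun M : ℝ => Real.exp 1 * ((1 + M) ^ k * Real.exp (-(1 + M)))) atTop
      (𝓝 0) := by
    simpa using ((Real.tendsto_pow_mul_exp_neg_atTop_nhds_zero k).comp
      (tendsto_atTop_add_const_left atTop 1 tendsto_id)).const_mul (Real.exp 1)
  refine squeeze_zero' ?_ ?_ (hexp.comp tendsto_cutoff)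
  · filter_upwards [self_mem_nhdsWithin] with ε hε
    exact mul_nonneg (le_of_lt hε) (pow_nonneg (by linarith [cutoff_nonneg ε]) k)
  · filter_upwards [Ioc_mem_nhdsGT zero_lt_one, tendsto_cutoff.eventually_ge_atTop 8]
      with ε hε hM
    have hle : ε ≤ Real.exp (-cutoff ε) := by
      rw [← Real.log_le_iff_le_exp hε.1]
      nlinarith [cutoff_sq hε]
    calc ε * (1 + cutoff ε) ^ k ≤ Real.exp (-cutoff ε) * (1 + cutoff ε) ^ k := by
          gcongr
      _ = Real.exp 1 * ((1 + cutoff ε) ^ k * Real.exp (-(1 + cutoff ε))) := by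
        rw [neg_add, Real.exp_add, Real.exp_neg 1]
        field_simp

section Cutoff

variable {δ : ℝ}

theorem PolyGrowthOn.eventually_abs_mul_le {f : ℝ → ℝ → ℝ → ℝ}
    (hf : PolyGrowthOn (paramSet δ) fun θ => f θ.1 θ.2) {c : ℝ} (hc : 0 < c) :
    ∀ᶠ ε in 𝓝[>] 0, ∀ p ∈ Icc δ (1 - δ), ∀ z, |z| ≤ cutoff ε → |ε * f ε p z| ≤ c := by
  obtain ⟨C, hC, k, hf⟩ := hf
  have htends : Tendsto (fun ε => C * (ε * (1 + cutoff ε) ^ k)) (𝓝[>] 0) (𝓝 0) := by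
    simpa only [mul_zero] using (tendsto_mul_cutoff_pow k).const_mul C
  filter_upwards [Ioc_mem_nhdsGT zero_lt_one, htends.eventually_le_const hc]
    with ε hε hle p hp z hz
  have hε₀ : 0 < ε := hε.1
  rw [abs_mul, abs_of_pos hε₀]
  calc ε * |f ε p z| ≤ ε * (C * (1 + |z|) ^ k) := by
        gcongr
        exact hf (ε, p) ⟨Ioc_subset_Icc_self hε, hp⟩ z
    _ ≤ ε * (C * (1 + cutoff ε) ^ k) := by gcongr
    _ = C * (ε * (1 + cutoff ε) ^ k) := by ring
    _ ≤ c := hle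

theorem eventually_isRegularAt (hδ : 0 < δ) :
    ∀ᶠ ε in 𝓝[>] 0, ∀ p ∈ Icc δ (1 - δ), ∀ z, |z| ≤ cutoff ε → IsRegularAt ε p z := by
  filter_upwards [(polyGrowthOn_successShift hδ).eventually_abs_mul_le one_half_pos,
    (polyGrowthOn_failureShift hδ).eventually_abs_mul_le one_half_pos,
    (polyGrowthOn_corrDeriv hδ).eventually_abs_mul_le one_half_pos]
    with ε hsuccess hfailure hderiv p hp z hz
  exact ⟨hsuccess p hp z hz, hfailure p hp z hz, hderiv p hp z hz⟩

theorem eventually_abs_logRatio_le_one (hδ : 0 < δ) :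
    ∀ᶠ ε in 𝓝[>] 0, ∀ p ∈ Icc δ (1 - δ), ∀ z, |z| ≤ cutoff ε → |logRatio ε p z| ≤ 1 := by
  obtain ⟨C, hC, k, hlog⟩ := exists_abs_logRatio_le hδ
  have hgrowth : PolyGrowthOn (paramSet δ) fun _ z => C * (1 + |z|) ^ k :=
    (PolyGrowthOn.const C).mul (((PolyGrowthOn.const 1).add PolyGrowthOn.var.abs).pow k)
  filter_upwards [Ioc_mem_nhdsGT zero_lt_one, eventually_isRegularAt hδ,
    hgrowth.eventually_abs_mul_le (f := fun _ _ z => C * (1 + |z|) ^ k) one_pos]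
    with ε hε hreg hle p hp z hz
  calc |logRatio ε p z| ≤ ε ^ 3 * (C * (1 + |z|) ^ k) :=
        hlog ε p z hε.1 ⟨Ioc_subset_Icc_self hε, hp⟩ (hreg p hp z hz)
    _ ≤ ε * (C * (1 + |z|) ^ k) := by
        gcongr
        exact pow_le_of_le_one hε.1.le hε.2 three_ne_zero
    _ ≤ 1 := (le_abs_self _).trans (hle p hp z hz)

end Cutoff

/-! ### Comparison of the binomial tail with the normal tail -/

theorem IsRegularAt.approxQuantile_mem_Ioo {ε p z : ℝ} (h : IsRegularAt ε p z)
    (hp : p ∈ Ioo 0 1) : approxQuantile ε p z ∈ Ioo 0 1 := by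
  have hq : 0 < 1 - p := sub_pos.2 hp.2
  refine ⟨?_, sub_pos.1 ?_⟩
  · rw [approxQuantile_eq_mul hp.1.ne']
    exact mul_pos hp.1 (by linarith [(abs_le.1 h.success).1])
  · rw [one_sub_approxQuantile_eq_mul hq.ne']
    exact mul_pos hq (by linarith [(abs_le.1 h.failure).2])

theorem IsRegularAt.one_half_le {ε p z : ℝ} (h : IsRegularAt ε p z) :
    1 / 2 ≤ 1 - ε * corrDeriv ε p z := by
  linarith [(abs_le.1 h.deriv).2]

theorem betaDensity_approxQuantile {n X : ℕ} {ε p z : ℝ} (hX : 1 ≤ X) (hXn : X ≤ n)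
    (hp : p ∈ Ioo 0 1) (h : IsRegularAt ε p z) :
    betaDensity n X (approxQuantile ε p z) = betaDensity n X p
      * Real.exp (((X : ℝ) - 1) * Real.log (1 + ε * successShift ε p z)
        + ((n : ℝ) - X) * Real.log (1 - ε * failureShift ε p z)) := by
  have hsuccess : 0 < 1 + ε * successShift ε p z := by linarith [(abs_le.1 h.success).1]
  have hfailure : 0 < 1 - ε * failureShift ε p z := by linarith [(abs_le.1 h.failure).2]
  have hq : 1 - p ≠ 0 := (sub_pos.2 hp.2).ne'
  rw [betaDensity, one_sub_approxQuantile_eq_mul hq, approxQuantile_eq_mul hp.1.ne', mul_pow,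
    mul_pow, ← Nat.cast_sub hXn, ← Nat.cast_pred hX, Real.exp_add, Real.exp_nat_mul,
    Real.exp_nat_mul, Real.exp_log hsuccess, Real.exp_log hfailure, betaDensity]
  ring

/-- The regime of the expansions: `ε = n ^ (-1/2)` and `p = X / n` is the observed proportion, at
distance at least `δ` from `0` and `1`. -/
structure Scaling (δ : ℝ) (n X : ℕ) (ε p : ℝ) : Prop where
  pos : 0 < ε
  sq_mul : ε ^ 2 * n = 1
  mul_eq : p * n = X
  mem : p ∈ Icc δ (1 - δ)

/-- The factor that does not depend on `z` in the ratio of the beta density transported by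
`approxQuantile ε p` to the standard normal density; the other factor is `exp (logRatio ε p z)`. -/
noncomputable def densityConst (n X : ℕ) (ε p : ℝ) : ℝ :=
  betaDensity n X p * (sd p * ε) * √(2 * Real.pi) * Real.exp (ε ^ 2 * normCorr p)

namespace Scaling

variable {δ ε p z : ℝ} {n X : ℕ}

theorem natCast_pos (h : Scaling δ n X ε p) : (0 : ℝ) < n :=
  pos_of_mul_pos_right (h.sq_mul ▸ one_pos) (sq_nonneg ε)

theorem mem_Ioc (h : Scaling δ n X ε p) : ε ∈ Ioc 0 1 := by
  have hn : (1 : ℝ) ≤ n := Nat.one_le_cast.2 (Nat.cast_pos.1 h.natCast_pos)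
  refine ⟨h.pos, (sq_le_one_iff₀ h.pos.le).1 ?_⟩
  calc ε ^ 2 ≤ ε ^ 2 * n := le_mul_of_one_le_right (sq_nonneg ε) hn
    _ = 1 := h.sq_mul

theorem mem_paramSet (h : Scaling δ n X ε p) : (ε, p) ∈ paramSet δ :=
  ⟨Ioc_subset_Icc_self h.mem_Ioc, h.mem⟩

theorem mem_Ioo (h : Scaling δ n X ε p) (hδ : 0 < δ) : p ∈ Ioo 0 1 :=
  mem_Ioo_of_mem_Icc hδ h.mem

theorem one_le (h : Scaling δ n X ε p) (hδ : 0 < δ) : 1 ≤ X :=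
  Nat.cast_pos.1 (h.mul_eq ▸ mul_pos (h.mem_Ioo hδ).1 h.natCast_pos)

theorem lt (h : Scaling δ n X ε p) (hδ : 0 < δ) : X < n :=
  Nat.cast_lt.1 (h.mul_eq ▸ mul_lt_of_lt_one_left h.natCast_pos (h.mem_Ioo hδ).2)

theorem densityConst_pos (h : Scaling δ n X ε p) (hδ : 0 < δ) : 0 < densityConst n X ε p := by
  have hdens := betaDensity_pos (h.one_le hδ) (h.lt hδ).le (h.mem_Ioo hδ)
  have hsd := sd_pos (h.mem_Ioo hδ)
  have hε := h.pos
  unfold densityConst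
  positivity

theorem betaDensity_mul_slope (h : Scaling δ n X ε p) (hδ : 0 < δ) (hz : IsRegularAt ε p z) :
    betaDensity n X (approxQuantile ε p z) * (sd p * ε * (1 - ε * corrDeriv ε p z))
      = densityConst n X ε p * (φ z * Real.exp (logRatio ε p z)) := by
  have hε := h.pos
  have hslope : 0 < 1 - ε * corrDeriv ε p z := one_half_pos.trans_le hz.one_half_le
  have hn : (n : ℝ) = 1 / ε ^ 2 := by
    rw [eq_div_iff (by positivity), mul_comm, h.sq_mul]
  have hexponent : ((X : ℝ) - 1) * Real.log (1 + ε * successShift ε p z)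
      + ((n : ℝ) - X) * Real.log (1 - ε * failureShift ε p z) + Real.log (1 - ε * corrDeriv ε p z)
      = ε ^ 2 * normCorr p + -z ^ 2 / 2 + logRatio ε p z := by
    rw [← h.mul_eq, hn, logRatio]
    ring
  have hnormal : Real.exp (-z ^ 2 / 2) = √(2 * Real.pi) * φ z := by
    simp only [gaussianPDFReal, NNReal.coe_one, mul_one, sub_zero]
    field_simp
  calc betaDensity n X (approxQuantile ε p z) * (sd p * ε * (1 - ε * corrDeriv ε p z))
      = betaDensity n X p * (sd p * ε) * (Real.exp (((X : ℝ) - 1)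
          * Real.log (1 + ε * successShift ε p z)
          + ((n : ℝ) - X) * Real.log (1 - ε * failureShift ε p z))
        * Real.exp (Real.log (1 - ε * corrDeriv ε p z))) := by
        rw [betaDensity_approxQuantile (h.one_le hδ) (h.lt hδ).le (h.mem_Ioo hδ) hz,
          Real.exp_log hslope]
        ring
    _ = densityConst n X ε p * (φ z * Real.exp (logRatio ε p z)) := by
        rw [← Real.exp_add, hexponent, Real.exp_add, Real.exp_add, hnormal, densityConst]
        ring

theorem hasDerivAt_binomGE_approxQuantile (h : Scaling δ n X ε p) (hδ : 0 < δ)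
    (hz : IsRegularAt ε p z) :
    HasDerivAt (fun z => binomGE n X (approxQuantile ε p z))
      (-(densityConst n X ε p * (φ z * Real.exp (logRatio ε p z)))) z := by
  rw [← h.betaDensity_mul_slope hδ hz, ← mul_neg]
  exact (hasDerivAt_binomGE (h.one_le hδ) (h.lt hδ).le _).comp z
    (hasDerivAt_approxQuantile ε p z)

end Scaling

theorem abs_sub_sub_mul_cdf_le {F L : ℝ → ℝ} {K D a b : ℝ} {k : ℕ} (hab : a ≤ b) (hK : 0 ≤ K)
    (hD : 0 ≤ D)
    (hF : ∀ z ∈ Icc a b, HasDerivAt F (-(K * (φ z * Real.exp (L z)))) z)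
    (hL : ∀ z ∈ Icc a b, |L z| ≤ D * (1 + |z|) ^ k) (hL_one : ∀ z ∈ Icc a b, |L z| ≤ 1) :
    |F a - F b - K * (Φ b - Φ a)| ≤ K * (2 * D * ∫ z, φ z * (1 + |z|) ^ k) := by
  have hderiv (z : ℝ) (hz : z ∈ Icc a b) : HasDerivAt (fun z => F z + K * Φ z)
      (-(K * φ z * (Real.exp (L z) - 1))) z :=
    ((hF z hz).add ((hasDerivAt_cdf_gaussianReal 0 one_ne_zero z).const_mul K)).congr_deriv
      (by ring)
  have hbound (z : ℝ) (hz : z ∈ Icc a b) :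
      ‖deriv (fun z => F z + K * Φ z) z‖ ≤ K * (2 * D) * (φ z * (1 + |z|) ^ k) := by
    have hφ := gaussianPDFReal_nonneg 0 1 z
    rw [(hderiv z hz).deriv, norm_neg, norm_mul, Real.norm_of_nonneg (mul_nonneg hK hφ),
      Real.norm_eq_abs]
    calc K * φ z * |Real.exp (L z) - 1| ≤ K * φ z * (2 * (D * (1 + |z|) ^ k)) := by
          gcongr
          exact (Real.abs_exp_sub_one_le (hL_one z hz)).trans
            (mul_le_mul_of_nonneg_left (hL z hz) zero_le_two)
      _ = K * (2 * D) * (φ z * (1 + |z|) ^ k) := by ring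
  have hmoment := integrable_gaussianPDFReal_mul_one_add_abs_pow 0 (v := 1) one_ne_zero k
  calc |F a - F b - K * (Φ b - Φ a)| = ‖(F b + K * Φ b) - (F a + K * Φ a)‖ := by
        rw [Real.norm_eq_abs, abs_sub_comm]
        congr 1
        ring
    _ ≤ ∫ z in a..b, K * (2 * D) * (φ z * (1 + |z|) ^ k) :=
        norm_sub_le_integral_of_norm_deriv_le_of_le hab
          (fun z hz => (hderiv z hz).continuousAt.continuousWithinAt)
          (fun z hz => (hderiv z (Ioo_subset_Icc_self hz)).differentiableAt
            |>.differentiableWithinAt)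
          (ae_of_all _ fun z hz => hbound z (Ioo_subset_Icc_self hz))
          (hmoment.const_mul _).intervalIntegrable
    _ ≤ K * (2 * D * ∫ z, φ z * (1 + |z|) ^ k) := by
        rw [intervalIntegral.integral_const_mul, intervalIntegral.integral_of_le hab, mul_assoc]
        refine mul_le_mul_of_nonneg_left (mul_le_mul_of_nonneg_left ?_ (by positivity)) hK
        exact setIntegral_le_integral hmoment (ae_of_all _ fun z =>
          mul_nonneg (gaussianPDFReal_nonneg 0 1 z) (by positivity))

theorem exists_abs_binomGE_increment_sub_le {δ : ℝ} (hδ : 0 < δ) :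
    ∃ C : ℝ, 0 ≤ C ∧ ∀ᶠ ε : ℝ in 𝓝[>] 0, ∀ (n X : ℕ) (p : ℝ), Scaling δ n X ε p →
      ∀ a b, -cutoff ε ≤ a → a ≤ b → b ≤ cutoff ε →
        |binomGE n X (approxQuantile ε p a) - binomGE n X (approxQuantile ε p b)
          - densityConst n X ε p * (Φ b - Φ a)| ≤ densityConst n X ε p * (C * ε ^ 3) := by
  obtain ⟨C, hC, k, hlog⟩ := exists_abs_logRatio_le hδ
  set I := ∫ z, φ z * (1 + |z|) ^ k
  have hI : 0 ≤ I := integral_nonneg fun z =>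
    mul_nonneg (gaussianPDFReal_nonneg 0 1 z) (by positivity)
  refine ⟨2 * C * I, by positivity, ?_⟩
  filter_upwards [eventually_isRegularAt hδ, eventually_abs_logRatio_le_one hδ]
    with ε hreg hlog_one n X p h a b ha hab hb
  have hε := h.pos
  have hcutoff (z : ℝ) (hz : z ∈ Icc a b) : |z| ≤ cutoff ε :=
    abs_le.2 ⟨ha.trans hz.1, hz.2.trans hb⟩
  convert abs_sub_sub_mul_cdf_le (F := fun z => binomGE n X (approxQuantile ε p z))
    (L := logRatio ε p) (D := ε ^ 3 * C) (k := k) hab (h.densityConst_pos hδ).le (by positivity)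
    (fun z hz => h.hasDerivAt_binomGE_approxQuantile hδ (hreg p h.mem z (hcutoff z hz)))
    (fun z hz => ?_) (fun z hz => hlog_one p h.mem z (hcutoff z hz)) using 2
  · ring
  · rw [mul_assoc]
    exact hlog ε p z hε h.mem_paramSet (hreg p h.mem z (hcutoff z hz))

theorem le_sd {δ p : ℝ} (hδ : 0 < δ) (hp : p ∈ Icc δ (1 - δ)) : δ ≤ sd p := by
  refine Real.le_sqrt_of_sq_le ?_
  rw [sq]
  exact mul_le_mul hp.1 (by linarith [hp.2]) hδ.le (hδ.le.trans hp.1)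

theorem abs_approxQuantile_sub_le {ε p z : ℝ} (hε : 0 ≤ ε) (hcorr : |ε * corr ε p z| ≤ 1) :
    |approxQuantile ε p z - (p - sd p * ε * z)| ≤ sd p * ε := by
  have hscale : 0 ≤ sd p * ε := mul_nonneg (sd_nonneg p) hε
  calc |approxQuantile ε p z - (p - sd p * ε * z)| = sd p * ε * |ε * corr ε p z| := by
        rw [← abs_of_nonneg hscale, ← abs_mul, abs_of_nonneg hscale, approxQuantile, stdQuantile]
        congr 1
        ring
    _ ≤ sd p * ε := mul_le_of_le_one_right hscale hcorr

theorem betaDensity_le_betaDensity {n X : ℕ} (hX : 1 ≤ X) (hXn : X ≤ n) {t x : ℝ}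
    (ht : t ∈ Icc 0 1) (hx : x ∈ Ioo 0 1) (h : (t - x) * (X - 1 - (n - 1) * x) ≤ 0) :
    betaDensity n X t ≤ betaDensity n X x := by
  have hx₀ : 0 < x := hx.1
  have hx₁ : 0 < 1 - x := sub_pos.2 hx.2
  have ht₁ : 0 ≤ 1 - t := sub_nonneg.2 ht.2
  -- By log-concavity the density lies below the exponential of its logarithmic tangent at `x`.
  have hpow {y : ℝ} (m : ℕ) (hy : 0 ≤ y) : y ^ m ≤ Real.exp (m * (y - 1)) := by
    rw [Real.exp_nat_mul]
    exact pow_le_pow_left₀ hy (by linarith [Real.add_one_le_exp (y - 1)]) m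
  have hexponent : ((X - 1 : ℕ) : ℝ) * (t / x - 1) + (n - X : ℕ) * ((1 - t) / (1 - x) - 1)
      = (t - x) * (X - 1 - (n - 1) * x) / (x * (1 - x)) := by
    rw [Nat.cast_pred hX, Nat.cast_sub hXn]
    field_simp
    ring
  have hratio : (t / x) ^ (X - 1) * ((1 - t) / (1 - x)) ^ (n - X) ≤ 1 := by
    calc (t / x) ^ (X - 1) * ((1 - t) / (1 - x)) ^ (n - X)
        ≤ Real.exp ((X - 1 : ℕ) * (t / x - 1))
          * Real.exp ((n - X : ℕ) * ((1 - t) / (1 - x) - 1)) := by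
          gcongr
          · exact hpow _ (div_nonneg ht.1 hx₀.le)
          · exact hpow _ (by positivity)
      _ ≤ 1 := by
          rw [← Real.exp_add, Real.exp_le_one_iff, hexponent]
          exact div_nonpos_of_nonpos_of_nonneg h (by positivity)
  rw [div_pow, div_pow, div_mul_div_comm, div_le_one (by positivity)] at hratio
  exact mul_le_mul_of_nonneg_left hratio (by positivity)

theorem binomGE_le_betaDensity {n X : ℕ} (hX : 1 ≤ X) (hXn : X ≤ n) {x : ℝ} (hx : x ∈ Ioo 0 1)
    (h : ((n : ℝ) - 1) * x ≤ X - 1) : binomGE n X x ≤ betaDensity n X x := by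
  obtain ⟨t, ht, hslope⟩ := exists_hasDerivAt_eq_slope (binomGE n X) _ hx.1
    (continuous_binomGE n X).continuousOn (fun t _ => hasDerivAt_binomGE hX hXn t)
  rw [binomGE_zero n hX, sub_zero, sub_zero, eq_div_iff hx.1.ne'] at hslope
  have ht₁ : t ∈ Icc 0 1 := ⟨ht.1.le, (ht.2.trans hx.2).le⟩
  calc binomGE n X x = betaDensity n X t * x := hslope.symm
    _ ≤ betaDensity n X t := mul_le_of_le_one_right (betaDensity_nonneg n X ht₁) hx.2.le
    _ ≤ betaDensity n X x := betaDensity_le_betaDensity hX hXn ht₁ hx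
        (mul_nonpos_of_nonpos_of_nonneg (sub_nonpos.2 ht.2.le) (sub_nonneg.2 h))

theorem one_sub_binomGE_le_betaDensity {n X : ℕ} (hX : 1 ≤ X) (hXn : X ≤ n) {x : ℝ}
    (hx : x ∈ Ioo 0 1) (h : (X : ℝ) - 1 ≤ (n - 1) * x) :
    1 - binomGE n X x ≤ betaDensity n X x := by
  obtain ⟨t, ht, hslope⟩ := exists_hasDerivAt_eq_slope (binomGE n X) _ hx.2
    (continuous_binomGE n X).continuousOn (fun t _ => hasDerivAt_binomGE hX hXn t)
  rw [binomGE_one hXn, eq_div_iff (sub_pos.2 hx.2).ne'] at hslope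
  have ht₁ : t ∈ Icc 0 1 := ⟨(hx.1.trans ht.1).le, ht.2.le⟩
  calc 1 - binomGE n X x = betaDensity n X t * (1 - x) := hslope.symm
    _ ≤ betaDensity n X t := mul_le_of_le_one_right (betaDensity_nonneg n X ht₁)
        (sub_le_self 1 hx.1.le)
    _ ≤ betaDensity n X x := betaDensity_le_betaDensity hX hXn ht₁ hx
        (mul_nonpos_of_nonneg_of_nonpos (sub_nonneg.2 ht.1.le) (sub_nonpos.2 h))

theorem Scaling.betaDensity_approxQuantile_le {δ ε p z : ℝ} {n X : ℕ} (h : Scaling δ n X ε p)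
    (hδ : 0 < δ) (hz : IsRegularAt ε p z) (hlog : |logRatio ε p z| ≤ 1) :
    betaDensity n X (approxQuantile ε p z) ≤ densityConst n X ε p * (6 / δ * (φ z / ε)) := by
  have hε := h.pos
  have hK := h.densityConst_pos hδ
  have hφ := gaussianPDFReal_nonneg 0 1 z
  have hdens := betaDensity_nonneg n X
    (Ioo_subset_Icc_self (hz.approxQuantile_mem_Ioo (h.mem_Ioo hδ)))
  have hexp : Real.exp (logRatio ε p z) ≤ 3 :=
    (Real.exp_le_exp.2 (le_of_abs_le hlog)).trans (by linarith [Real.exp_one_lt_d9])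
  have hmul : betaDensity n X (approxQuantile ε p z) * (δ * ε * (1 / 2))
      ≤ densityConst n X ε p * (φ z * 3) := by
    calc betaDensity n X (approxQuantile ε p z) * (δ * ε * (1 / 2))
        ≤ betaDensity n X (approxQuantile ε p z) * (sd p * ε * (1 - ε * corrDeriv ε p z)) := by
          gcongr
          · exact mul_nonneg (sd_nonneg p) hε.le
          · exact le_sd hδ h.mem
          · exact hz.one_half_le
      _ = densityConst n X ε p * (φ z * Real.exp (logRatio ε p z)) := h.betaDensity_mul_slope hδ hz
      _ ≤ densityConst n X ε p * (φ z * 3) := by gcongr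
  rw [← le_div_iff₀ (by positivity)] at hmul
  refine hmul.trans_eq ?_
  field_simp
  ring

theorem eventually_betaDensity_cutoff_le {δ : ℝ} (hδ : 0 < δ) :
    ∀ᶠ ε : ℝ in 𝓝[>] 0, ∀ (n X : ℕ) (p : ℝ), Scaling δ n X ε p → ∀ z, |z| = cutoff ε →
      betaDensity n X (approxQuantile ε p z) ≤ densityConst n X ε p * (6 / δ * ε ^ 3) := by
  filter_upwards [eventually_isRegularAt hδ, eventually_abs_logRatio_le_one hδ]
    with ε hreg hlog n X p h z hz
  have hε := h.pos
  have hφ : φ z ≤ ε ^ 4 := by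
    rw [← exp_neg_cutoff_sq h.mem_Ioc, ← hz, sq_abs]
    exact gaussianPDFReal_zero_one_le z
  refine (h.betaDensity_approxQuantile_le hδ (hreg p h.mem z hz.le) (hlog p h.mem z hz.le)).trans ?_
  refine mul_le_mul_of_nonneg_left ?_ (h.densityConst_pos hδ).le
  gcongr
  rw [div_le_iff₀ hε, ← pow_succ]
  exact hφ

theorem eventually_binomGE_cutoff_le {δ : ℝ} (hδ : 0 < δ) :
    ∀ᶠ ε : ℝ in 𝓝[>] 0, ∀ (n X : ℕ) (p : ℝ), Scaling δ n X ε p →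
      binomGE n X (approxQuantile ε p (cutoff ε)) ≤ densityConst n X ε p * (6 / δ * ε ^ 3) := by
  filter_upwards [eventually_isRegularAt hδ, eventually_betaDensity_cutoff_le hδ,
    (polyGrowthOn_corr hδ).eventually_abs_mul_le one_pos,
    tendsto_cutoff.eventually_ge_atTop (1 + 1 / δ)] with ε hreg hdens hcorr hM n X p h
  have hε := h.pos
  have hXε : ε ^ 2 ≤ p := by
    calc ε ^ 2 ≤ ε ^ 2 * X := le_mul_of_one_le_right (sq_nonneg ε) (Nat.one_le_cast.2 (h.one_le hδ))
      _ = p := by rw [← h.mul_eq, mul_left_comm, h.sq_mul, mul_one]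
  have hM_abs : |cutoff ε| = cutoff ε := abs_of_nonneg (cutoff_nonneg ε)
  have hle : approxQuantile ε p (cutoff ε) ≤ p - ε ^ 2 := by
    have hexpand := abs_le.1 (abs_approxQuantile_sub_le hε.le (hcorr p h.mem _ hM_abs.le))
    have hgap : ε ^ 2 ≤ sd p * ε * (cutoff ε - 1) := by
      have hone : 1 ≤ δ * (cutoff ε - 1) := by
        rw [← div_le_iff₀' hδ]
        linarith
      nlinarith [h.mem_Ioc.2, mul_le_mul_of_nonneg_right (le_sd hδ h.mem)
        (pos_of_mul_pos_right (one_pos.trans_le hone) hδ.le).le]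
    linarith [hexpand.2]
  refine (binomGE_le_betaDensity (h.one_le hδ) (h.lt hδ).le
    ((hreg p h.mem _ hM_abs.le).approxQuantile_mem_Ioo (h.mem_Ioo hδ)) ?_).trans
    (hdens n X p h _ hM_abs)
  have hn : (0 : ℝ) ≤ n - 1 :=
    sub_nonneg.2 (Nat.one_le_cast.2 ((h.one_le hδ).trans (h.lt hδ).le))
  nlinarith [mul_le_mul_of_nonneg_left hle hn, h.mul_eq, h.sq_mul]

theorem eventually_one_sub_binomGE_neg_cutoff_le {δ : ℝ} (hδ : 0 < δ) :
    ∀ᶠ ε : ℝ in 𝓝[>] 0, ∀ (n X : ℕ) (p : ℝ), Scaling δ n X ε p →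
      1 - binomGE n X (approxQuantile ε p (-cutoff ε))
        ≤ densityConst n X ε p * (6 / δ * ε ^ 3) := by
  filter_upwards [eventually_isRegularAt hδ, eventually_betaDensity_cutoff_le hδ,
    (polyGrowthOn_corr hδ).eventually_abs_mul_le one_pos,
    tendsto_cutoff.eventually_ge_atTop 1] with ε hreg hdens hcorr hM n X p h
  have hM_abs : |-cutoff ε| = cutoff ε := by rw [abs_neg, abs_of_nonneg (cutoff_nonneg ε)]
  have hle : p ≤ approxQuantile ε p (-cutoff ε) := by
    have hexpand := abs_le.1 (abs_approxQuantile_sub_le h.pos.le (hcorr p h.mem _ hM_abs.le))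
    have hgap : sd p * ε * 1 ≤ sd p * ε * cutoff ε :=
      mul_le_mul_of_nonneg_left hM (mul_nonneg (sd_nonneg p) h.pos.le)
    linarith [hexpand.1]
  refine (one_sub_binomGE_le_betaDensity (h.one_le hδ) (h.lt hδ).le
    ((hreg p h.mem _ hM_abs.le).approxQuantile_mem_Ioo (h.mem_Ioo hδ)) ?_).trans
    (hdens n X p h _ hM_abs)
  have hn : (0 : ℝ) ≤ n - 1 :=
    sub_nonneg.2 (Nat.one_le_cast.2 ((h.one_le hδ).trans (h.lt hδ).le))
  linarith [mul_le_mul_of_nonneg_left hle hn, h.mul_eq, (h.mem_Ioo hδ).2]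

theorem abs_sub_one_sub_le_of_increments {F H : ℝ → ℝ} {K η M z : ℝ} (hK : 0 < K)
    (hη : η ∈ Icc 0 (1 / 16)) (hz : |z| ≤ M) (hH : ∀ x, H x ∈ Icc 0 1)
    (hH_left : H (-M) ≤ η) (hH_right : 1 - H M ≤ η)
    (hF_left : 1 - F (-M) ∈ Icc 0 (K * η)) (hF_right : F M ∈ Icc 0 (K * η))
    (hincr : ∀ a b, -M ≤ a → a ≤ b → b ≤ M → |F a - F b - K * (H b - H a)| ≤ K * η) :
    |F z - (1 - H z)| ≤ 18 * η := by
  obtain ⟨hz_left, hz_right⟩ := abs_le.1 hz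
  have hleft := abs_le.1 (hincr (-M) z le_rfl hz_left hz_right)
  have hright := abs_le.1 (hincr z M hz_left hz_right le_rfl)
  have hKη := mul_le_mul_of_nonneg_left hη.2 hK.le
  have hK_left := mul_le_mul_of_nonneg_left hH_left hK.le
  have hK_right := mul_le_mul_of_nonneg_left hH_right hK.le
  have hK_left' := mul_nonneg hK.le (hH (-M)).1
  have hK_right' := mul_le_mul_of_nonneg_left (hH M).2 hK.le
  -- The tails being small, the increment over all of `[-M, M]` forces `K` to be close to `1`.
  have hK_one : |K - 1| ≤ 6 * (K * η) :=
    abs_le.2 ⟨by linarith [hF_left.2, hF_right.2], by linarith [hF_left.1, hF_right.1]⟩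
  have hK_two : K * η ≤ 2 * η :=
    mul_le_mul_of_nonneg_right (by linarith [(abs_le.1 hK_one).2]) hη.1
  have hprod : |(K - 1) * (1 - H z)| ≤ 6 * (K * η) := by
    rw [abs_mul, abs_of_nonneg (sub_nonneg.2 (hH z).2)]
    exact (mul_le_of_le_one_right (abs_nonneg _) (sub_le_self 1 (hH z).1)).trans hK_one
  rw [abs_le] at hprod ⊢
  constructor <;> linarith [hprod.1, hprod.2, hF_right.1, hF_right.2]

theorem eventually_approxQuantile_mem_Icc {δ : ℝ} (hδ : 0 < δ) :
    ∀ᶠ ε : ℝ in 𝓝[>] 0, ∀ p ∈ Icc δ (1 - δ), ∀ z, |z| ≤ cutoff ε →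
      approxQuantile ε p z ∈ Icc 0 1 := by
  filter_upwards [eventually_isRegularAt hδ] with ε hreg p hp z hz
  exact Ioo_subset_Icc_self ((hreg p hp z hz).approxQuantile_mem_Ioo (mem_Ioo_of_mem_Icc hδ hp))

theorem exists_abs_binomGE_approxQuantile_sub_le {δ : ℝ} (hδ : 0 < δ) :
    ∃ C : ℝ, 0 < C ∧ ∀ᶠ ε : ℝ in 𝓝[>] 0, ∀ (n X : ℕ) (p : ℝ), Scaling δ n X ε p →
      ∀ z, |z| ≤ cutoff ε →
        |binomGE n X (approxQuantile ε p z) - (1 - Φ z)| ≤ C * ε ^ 3 := by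
  obtain ⟨C, hC, hincr⟩ := exists_abs_binomGE_increment_sub_le hδ
  set D := C + 6 / δ + 1
  have hCD : C ≤ D := by linarith [show 0 < 6 / δ by positivity]
  have hδD : 6 / δ ≤ D := by linarith
  have hD : 1 ≤ D := by linarith [show 0 < 6 / δ by positivity]
  have hsmall : Tendsto (fun ε : ℝ => D * ε ^ 3) (𝓝[>] 0) (𝓝 0) := by
    refine ((by fun_prop : Continuous fun ε : ℝ => D * ε ^ 3).tendsto' 0 0 (by simp)).mono_left
      nhdsWithin_le_nhds
  refine ⟨18 * D, by positivity, ?_⟩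
  filter_upwards [hsmall.eventually_le_const (show (0 : ℝ) < 1 / 16 by norm_num), hincr,
    eventually_binomGE_cutoff_le hδ, eventually_one_sub_binomGE_neg_cutoff_le hδ,
    eventually_approxQuantile_mem_Icc hδ] with ε hη hincr hright hleft hmem n X p h z hz
  have hε := h.pos
  have hK := h.densityConst_pos hδ
  have hM := cutoff_nonneg ε
  have hweaken {c : ℝ} (hc : c ≤ D) :
      densityConst n X ε p * (c * ε ^ 3) ≤ densityConst n X ε p * (D * ε ^ 3) := by gcongr
  have htail : Real.exp (-cutoff ε ^ 2 / 2) ≤ D * ε ^ 3 := by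
    rw [exp_neg_cutoff_sq h.mem_Ioc, pow_succ']
    gcongr
    exact h.mem_Ioc.2.trans hD
  have hF (z : ℝ) (hz : |z| ≤ cutoff ε) : binomGE n X (approxQuantile ε p z) ∈ Icc 0 1 :=
    binomGE_mem_Icc (h.one_le hδ) (h.lt hδ).le (hmem p h.mem z hz)
  rw [mul_assoc]
  exact abs_sub_one_sub_le_of_increments (F := fun z => binomGE n X (approxQuantile ε p z)) hK
    ⟨by positivity, hη⟩ hz (fun x => ⟨cdf_nonneg _ x, cdf_le_one _ x⟩)
    ((cdf_gaussianReal_neg_le hM).trans htail) ((one_sub_cdf_gaussianReal_le hM).trans htail)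
    ⟨sub_nonneg.2 (hF _ (by rw [abs_neg, abs_of_nonneg hM])).2,
      (hleft n X p h).trans (hweaken hδD)⟩
    ⟨(hF _ (abs_of_nonneg hM).le).1, (hright n X p h).trans (hweaken hδD)⟩
    (fun a b ha hab hb => (hincr n X p h a b ha hab hb).trans (hweaken hCD))

/-! ### Inversion -/

theorem exists_abs_approxQuantile_sub_le {δ : ℝ} (hδ : 0 < δ) (z : ℝ) :
    ∃ B : ℝ, 0 ≤ B ∧ ∀ ε p : ℝ, (ε, p) ∈ paramSet δ → ∀ w ∈ Icc (z - 1) (z + 1),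
      |approxQuantile ε p w - approxQuantile ε p z| ≤ B * ε * |w - z| := by
  obtain ⟨C, hC, k, hgrowth⟩ := polyGrowthOn_sd.mul
    ((PolyGrowthOn.const 1).sub (polyGrowthOn_fst.mul (polyGrowthOn_corrDeriv hδ)))
  refine ⟨C * (2 + |z|) ^ k, by positivity, fun ε p hθ w hw => ?_⟩
  have hε : 0 ≤ ε := hθ.1.1
  have hslope (t : ℝ) (ht : t ∈ Icc (z - 1) (z + 1)) :
      ‖-(sd p * ε * (1 - ε * corrDeriv ε p t))‖ ≤ C * (2 + |z|) ^ k * ε := by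
    have htz : |t| ≤ 1 + |z| := by
      have hdist : |t - z| ≤ 1 := abs_le.2 ⟨by linarith [ht.1], by linarith [ht.2]⟩
      linarith [abs_sub_abs_le_abs_sub t z]
    calc ‖-(sd p * ε * (1 - ε * corrDeriv ε p t))‖
        = |sd p * (1 - ε * corrDeriv ε p t)| * ε := by
          rw [norm_neg, Real.norm_eq_abs, mul_right_comm, abs_mul, abs_of_nonneg hε]
      _ ≤ C * (1 + |t|) ^ k * ε := mul_le_mul_of_nonneg_right (hgrowth (ε, p) hθ t) hε
      _ ≤ C * (2 + |z|) ^ k * ε := by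
          have hle : 1 + |t| ≤ 2 + |z| := by linarith
          gcongr ?_ * ?_ ^ k * ε
  exact (convex_Icc (z - 1) (z + 1)).norm_image_sub_le_of_norm_hasDerivWithin_le
    (fun t _ => (hasDerivAt_approxQuantile ε p t).hasDerivWithinAt) hslope
    ⟨by linarith, by linarith⟩ hw

section Lower

variable {a δ : ℝ}

theorem Scaling.abs_lower_sub_approxQuantile_le {ε p η t r : ℝ} {n X : ℕ}
    (h : Scaling δ n X ε p) (hδ : 0 < δ) (ha0 : 0 < a) (ha1 : a < 1)
    (hmem : ∀ w ∈ ({zUpper a - t, zUpper a + t} : Set ℝ), approxQuantile ε p w ∈ Icc 0 1)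
    (htail : ∀ w ∈ ({zUpper a - t, zUpper a + t} : Set ℝ),
      |binomGE n X (approxQuantile ε p w) - (1 - Φ w)| ≤ η)
    (hleft : η ≤ Φ (zUpper a) - Φ (zUpper a - t)) (hright : η ≤ Φ (zUpper a + t) - Φ (zUpper a))
    (hdist : ∀ w ∈ ({zUpper a - t, zUpper a + t} : Set ℝ),
      |approxQuantile ε p w - approxQuantile ε p (zUpper a)| ≤ r) :
    |lower a n X - approxQuantile ε p (zUpper a)| ≤ r := by
  have hX := h.one_le hδ
  have hXn := (h.lt hδ).le
  have hmono := strictMonoOn_binomGE hX hXn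
  have hlower := lower_mem_Icc ha0 ha1 hX hXn
  have hlower_eq : binomGE n X (lower a n X) = a :=
    (binomGE_eq_iff_eq_lower ha0 ha1 hX hXn hlower).2 rfl
  have hΦ := cdf_zUpper ha0 ha1
  simp only [mem_insert_iff, mem_singleton_iff, forall_eq_or_imp, forall_eq] at hmem htail hdist
  have hle : lower a n X ≤ approxQuantile ε p (zUpper a - t) := by
    rw [← hmono.le_iff_le hlower hmem.1, hlower_eq]
    linarith [(abs_le.1 htail.1).1]
  have hge : approxQuantile ε p (zUpper a + t) ≤ lower a n X := by
    rw [← hmono.le_iff_le hmem.2 hlower, hlower_eq]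
    linarith [(abs_le.1 htail.2).2]
  exact abs_le.2 ⟨by linarith [(abs_le.1 hdist.2).1], by linarith [(abs_le.1 hdist.1).2]⟩

theorem exists_eventually_abs_lower_sub_approxQuantile_le (hδ : 0 < δ) (ha0 : 0 < a)
    (ha1 : a < 1) :
    ∃ C : ℝ, 0 ≤ C ∧ ∀ᶠ ε : ℝ in 𝓝[>] 0, ∀ (n X : ℕ) (p : ℝ), Scaling δ n X ε p →
      |lower a n X - approxQuantile ε p (zUpper a)| ≤ C * ε ^ 4 := by
  set z := zUpper a
  obtain ⟨C, hC, htail⟩ := exists_abs_binomGE_approxQuantile_sub_le hδ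
  obtain ⟨B, hB, hlip⟩ := exists_abs_approxQuantile_sub_le hδ z
  obtain ⟨c, hc, hcdf⟩ := exists_mul_sub_le_cdf_gaussianReal_sub 0 (v := 1) one_ne_zero
    (z - 1) (z + 1)
  have hsmall : Tendsto (fun ε : ℝ => C / c * ε ^ 3) (𝓝[>] 0) (𝓝 0) :=
    ((by fun_prop : Continuous fun ε : ℝ => C / c * ε ^ 3).tendsto' 0 0 (by simp)).mono_left
      nhdsWithin_le_nhds
  refine ⟨B * (C / c), by positivity, ?_⟩
  filter_upwards [htail, eventually_approxQuantile_mem_Icc hδ, hsmall.eventually_le_const one_pos,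
    tendsto_cutoff.eventually_ge_atTop (|z| + 1)] with ε htail hmem ht_one hM n X p h
  set t := C / c * ε ^ 3 with ht
  have ht₀ : 0 ≤ t := mul_nonneg (by positivity) (pow_nonneg h.pos.le 3)
  have hdist (w : ℝ) (hw : w ∈ ({z - t, z + t} : Set ℝ)) : |w - z| = t := by
    rcases hw with rfl | rfl
    · rw [sub_sub_cancel_left, abs_neg, abs_of_nonneg ht₀]
    · rw [add_sub_cancel_left, abs_of_nonneg ht₀]
  have hcutoff (w : ℝ) (hw : w ∈ ({z - t, z + t} : Set ℝ)) : |w| ≤ cutoff ε := by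
    linarith [abs_sub_abs_le_abs_sub w z, hdist w hw]
  have hnear {w : ℝ} (hw : |w - z| ≤ 1) : w ∈ Icc (z - 1) (z + 1) :=
    ⟨by linarith [(abs_le.1 hw).1], by linarith [(abs_le.1 hw).2]⟩
  have hz : z ∈ Icc (z - 1) (z + 1) := hnear (by simp)
  have hz_left := hnear ((hdist (z - t) (.inl rfl)).trans_le ht_one)
  have hz_right := hnear ((hdist (z + t) (.inr rfl)).trans_le ht_one)
  have hct : c * t = C * ε ^ 3 := by
    rw [ht]
    field_simp
  refine h.abs_lower_sub_approxQuantile_le hδ ha0 ha1 (t := t)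
    (fun w hw => hmem p h.mem w (hcutoff w hw)) (fun w hw => htail n X p h w (hcutoff w hw))
    ?_ ?_ fun w hw => ?_
  · simpa [hct] using hcdf _ hz_left z hz (by linarith)
  · simpa [hct] using hcdf z hz _ hz_right (by linarith)
  · refine (hlip ε p h.mem_paramSet w (hnear ((hdist w hw).trans_le ht_one))).trans_eq ?_
    rw [hdist w hw, ht]
    ring

theorem polyGrowthOn_approxQuantile (hδ : 0 < δ) :
    PolyGrowthOn (paramSet δ) (fun θ => approxQuantile θ.1 θ.2) :=
  polyGrowthOn_snd.add ((polyGrowthOn_sd.mul polyGrowthOn_fst).mul (polyGrowthOn_stdQuantile hδ))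

theorem exists_abs_lower_sub_approxQuantile_le (hδ : 0 < δ) (ha0 : 0 < a) (ha1 : a < 1) :
    ∃ C : ℝ, 0 ≤ C ∧ ∀ (ε p : ℝ) (n X : ℕ), Scaling δ n X ε p →
      |lower a n X - approxQuantile ε p (zUpper a)| ≤ C * ε ^ 4 := by
  obtain ⟨C, hC, hsmall⟩ := exists_eventually_abs_lower_sub_approxQuantile_le hδ ha0 ha1
  obtain ⟨B, hB, k, hgrowth⟩ := polyGrowthOn_approxQuantile hδ
  obtain ⟨u, hu, hsmall⟩ := mem_nhdsGT_iff_exists_Ioo_subset.1 hsmall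
  have hu : 0 < u := hu
  set A := 1 + B * (1 + |zUpper a|) ^ k
  refine ⟨max C (A / u ^ 4), le_max_of_le_left hC, fun ε p n X h => ?_⟩
  have hε := h.pos
  rcases lt_or_ge ε u with hlt | hge
  · refine (hsmall ⟨hε, hlt⟩ n X p h).trans ?_
    gcongr
    exact le_max_left _ _
  · have hlower := lower_mem_Icc ha0 ha1 (h.one_le hδ) (h.lt hδ).le
    calc |lower a n X - approxQuantile ε p (zUpper a)|
        ≤ |lower a n X| + |approxQuantile ε p (zUpper a)| := abs_sub _ _
      _ ≤ A := add_le_add (abs_le.2 ⟨by linarith [hlower.1], hlower.2⟩)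
          (hgrowth (ε, p) h.mem_paramSet _)
      _ = A / u ^ 4 * u ^ 4 := by field_simp
      _ ≤ max C (A / u ^ 4) * ε ^ 4 := by
          gcongr
          exact le_max_right _ _

end Lower

/-! ### The expansions -/

theorem rpow_neg_half_pow {n : ℝ} (hn : 0 ≤ n) (k : ℕ) :
    (n ^ (-(1 / 2) : ℝ)) ^ k = n ^ (-(k / 2) : ℝ) := by
  rw [← Real.rpow_mul_natCast hn]
  congr 1
  ring

theorem Scaling.of_div_mem_Icc {δ : ℝ} {n X : ℕ} (hn : 0 < n) (hp : (X : ℝ) / n ∈ Icc δ (1 - δ)) :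
    Scaling δ n X ((n : ℝ) ^ (-(1 / 2) : ℝ)) ((X : ℝ) / n) where
  pos := Real.rpow_pos_of_pos (Nat.cast_pos.2 hn) _
  sq_mul := by
    have hn' : (n : ℝ) ≠ 0 := Nat.cast_ne_zero.2 hn.ne'
    rw [rpow_neg_half_pow n.cast_nonneg, Nat.cast_two, div_self two_ne_zero, Real.rpow_neg_one,
      inv_mul_cancel₀ hn']
  mul_eq := div_mul_cancel₀ _ (Nat.cast_ne_zero.2 hn.ne')
  mem := hp

theorem lowerExpRefined_eq_lowerExp_add {n : ℝ} (hn : 0 ≤ n) (p z : ℝ) :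
    lowerExpRefined n p z = lowerExp n p z + (n ^ (-(1 / 2) : ℝ)) ^ 3 * (sd p * corr₂ p z) := by
  rw [lowerExpRefined, rpow_neg_half_pow hn, Nat.cast_ofNat, ← Real.sqrt_eq_rpow, corr₂, sd]
  ring

theorem lowerExpRefined_eq_approxQuantile {n p : ℝ} (hn : 0 ≤ n) (hp : p ∈ Ioo 0 1) (z : ℝ) :
    lowerExpRefined n p z = approxQuantile (n ^ (-(1 / 2) : ℝ)) p z := by
  have hs := sd_pos hp
  have hcorr : sd p * corr₁ p z = (2 * (1 / 2 - p) * z ^ 2 - (1 + p)) / 3 := by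
    rw [corr₁]
    field_simp
  have hinv : n⁻¹ = (n ^ (-(1 / 2) : ℝ)) ^ 2 := by
    rw [rpow_neg_half_pow hn, Nat.cast_two, div_self two_ne_zero, Real.rpow_neg_one]
  rw [lowerExpRefined_eq_lowerExp_add hn, lowerExp, ← Real.sqrt_eq_rpow, mul_inv, hinv, ← sd,
    approxQuantile, stdQuantile, corr]
  linear_combination -(n ^ (-(1 / 2) : ℝ)) ^ 2 * hcorr

theorem exists_abs_lower_sub_lowerExpRefined_le {a δ : ℝ} (hδ : 0 < δ) (ha0 : 0 < a)
    (ha1 : a < 1) :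
    ∃ C : ℝ, 0 ≤ C ∧ ∀ n X : ℕ, 0 < n → (X : ℝ) / n ∈ Icc δ (1 - δ) →
      |lower a n X - lowerExpRefined n ((X : ℝ) / n) (zUpper a)| ≤ C * (n : ℝ) ^ (-2 : ℝ) := by
  obtain ⟨C, hC, hlower⟩ := exists_abs_lower_sub_approxQuantile_le hδ ha0 ha1
  refine ⟨C, hC, fun n X hn hp => ?_⟩
  have h := Scaling.of_div_mem_Icc hn hp
  have hfourth : ((n : ℝ) ^ (-(1 / 2) : ℝ)) ^ 4 = (n : ℝ) ^ (-2 : ℝ) := by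
    rw [rpow_neg_half_pow n.cast_nonneg]
    norm_num
  rw [lowerExpRefined_eq_approxQuantile n.cast_nonneg (h.mem_Ioo hδ), ← hfourth]
  exact hlower _ _ n X h

theorem exists_abs_lowerExpRefined_sub_lowerExp_le {δ : ℝ} (hδ : 0 < δ) (z : ℝ) :
    ∃ C : ℝ, ∀ n : ℝ, 1 ≤ n → ∀ p ∈ Icc δ (1 - δ),
      |lowerExpRefined n p z - lowerExp n p z| ≤ C * n ^ (-(3 / 2) : ℝ) := by
  obtain ⟨C, -, k, hgrowth⟩ := polyGrowthOn_sd.mul (polyGrowthOn_corr₂ hδ)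
  refine ⟨C * (1 + |z|) ^ k, fun n hn p hp => ?_⟩
  have hn₀ : 0 ≤ n := zero_le_one.trans hn
  have hε : 0 ≤ n ^ (-(1 / 2) : ℝ) := Real.rpow_nonneg hn₀ _
  have hε_one : n ^ (-(1 / 2) : ℝ) ≤ 1 := Real.rpow_le_one_of_one_le_of_nonpos hn (by norm_num)
  have hcube : (n ^ (-(1 / 2) : ℝ)) ^ 3 = n ^ (-(3 / 2) : ℝ) := rpow_neg_half_pow hn₀ 3
  rw [lowerExpRefined_eq_lowerExp_add hn₀, add_sub_cancel_left, abs_mul,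
    abs_of_nonneg (pow_nonneg hε 3), mul_comm, ← hcube]
  exact mul_le_mul_of_nonneg_right (hgrowth (n ^ (-(1 / 2) : ℝ), p) ⟨⟨hε, hε_one⟩, hp⟩ z)
    (pow_nonneg hε 3)

theorem exists_abs_lower_sub_le {a δ : ℝ} (hδ : 0 < δ) (ha0 : 0 < a) (ha1 : a < 1) :
    ∃ C : ℝ, ∀ n X : ℕ, 0 < n → (X : ℝ) / n ∈ Icc δ (1 - δ) →
      |lower a n X - lowerExp n ((X : ℝ) / n) (zUpper a)| ≤ C * (n : ℝ) ^ (-(3 / 2) : ℝ) ∧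
      |lower a n X - lowerExpRefined n ((X : ℝ) / n) (zUpper a)| ≤ C * (n : ℝ) ^ (-2 : ℝ) := by
  obtain ⟨C, hC, hrefined⟩ := exists_abs_lower_sub_lowerExpRefined_le hδ ha0 ha1
  obtain ⟨D, hterm⟩ := exists_abs_lowerExpRefined_sub_lowerExp_le hδ (zUpper a)
  refine ⟨max C (C + D), fun n X hn hp => ⟨?_, ?_⟩⟩
  · have hn_one : (1 : ℝ) ≤ n := Nat.one_le_cast.2 hn
    calc |lower a n X - lowerExp n ((X : ℝ) / n) (zUpper a)|
        ≤ C * (n : ℝ) ^ (-2 : ℝ) + D * (n : ℝ) ^ (-(3 / 2) : ℝ) :=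
          (abs_sub_le _ _ _).trans (add_le_add (hrefined n X hn hp) (hterm n hn_one _ hp))
      _ ≤ C * (n : ℝ) ^ (-(3 / 2) : ℝ) + D * (n : ℝ) ^ (-(3 / 2) : ℝ) := by
          gcongr ?_ + _
          exact mul_le_mul_of_nonneg_left
            (Real.rpow_le_rpow_of_exponent_le hn_one (by norm_num)) hC
      _ = (C + D) * (n : ℝ) ^ (-(3 / 2) : ℝ) := (add_mul _ _ _).symm
      _ ≤ max C (C + D) * (n : ℝ) ^ (-(3 / 2) : ℝ) := by
          gcongr
          exact le_max_right _ _
  · refine (hrefined n X hn hp).trans ?_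
    gcongr
    exact le_max_left _ _

theorem natCast_sub_div_natCast {n X : ℕ} (hXn : X < n) :
    ((n - X : ℕ) : ℝ) / n = 1 - (X : ℝ) / n := by
  rw [Nat.cast_sub hXn.le, sub_div, div_self (Nat.cast_ne_zero.2 (Nat.ne_zero_of_lt hXn))]

theorem upperExp_eq_one_sub_lowerExp (n p z : ℝ) :
    upperExp n p z = 1 - lowerExp n (1 - p) z := by
  rw [upperExp, lowerExp, sub_sub_cancel, mul_comm (1 - p) p]
  ring

theorem upperExpRefined_eq_one_sub_lowerExpRefined (n p z : ℝ) :
    upperExpRefined n p z = 1 - lowerExpRefined n (1 - p) z := by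
  rw [upperExpRefined, lowerExpRefined, upperExp_eq_one_sub_lowerExp, sub_sub_cancel,
    mul_comm (1 - p) p]
  ring

section Upper

variable {a : ℝ} {n X : ℕ}

theorem abs_upper_sub_upperExp (ha0 : 0 < a) (ha1 : a < 1) (hXn : X < n) (z : ℝ) :
    |upper a n X - upperExp n ((X : ℝ) / n) z|
      = |lower a n (n - X) - lowerExp n (((n - X : ℕ) : ℝ) / n) z| := by
  rw [natCast_sub_div_natCast hXn, upper_eq_one_sub_lower ha0 ha1 hXn,
    upperExp_eq_one_sub_lowerExp, sub_sub_sub_cancel_left, abs_sub_comm]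

theorem abs_upper_sub_upperExpRefined (ha0 : 0 < a) (ha1 : a < 1) (hXn : X < n) (z : ℝ) :
    |upper a n X - upperExpRefined n ((X : ℝ) / n) z|
      = |lower a n (n - X) - lowerExpRefined n (((n - X : ℕ) : ℝ) / n) z| := by
  rw [natCast_sub_div_natCast hXn, upper_eq_one_sub_lower ha0 ha1 hXn,
    upperExpRefined_eq_one_sub_lowerExpRefined, sub_sub_sub_cancel_left, abs_sub_comm]

end Upper

end ClopperPearson

/-- `a = α / 2` gives the two-sided `1 - α` Clopper–Pearson interval, `a = α` the one-sided
`1 - α` bounds. The first part says that the beta quantiles are the limits obtained by inverting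
the binomial tests; the second part is the expansion, uniformly for `X / n` in `[δ, 1 - δ]`. -/
theorem theorem1 (α : ℝ) (hα0 : 0 < α) (hα1 : α < 1) (a : ℝ) (ha : a = α / 2 ∨ a = α) :
    (∀ n X : ℕ, 1 ≤ X → X < n →
      (ClopperPearson.lower a n X ∈ Set.Icc (0 : ℝ) 1 ∧
        ∀ p ∈ Set.Icc (0 : ℝ) 1,
          (ClopperPearson.binomGE n X p = a ↔ p = ClopperPearson.lower a n X)) ∧
      (ClopperPearson.upper a n X ∈ Set.Icc (0 : ℝ) 1 ∧
        ∀ p ∈ Set.Icc (0 : ℝ) 1,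
          (ClopperPearson.binomLE n X p = a ↔ p = ClopperPearson.upper a n X))) ∧
    (∀ δ : ℝ, 0 < δ → ∃ C : ℝ, ∀ n X : ℕ, 1 ≤ X → X < n →
      δ ≤ (X : ℝ) / n → (X : ℝ) / n ≤ 1 - δ →
      |ClopperPearson.lower a n X
          - ClopperPearson.lowerExp n ((X : ℝ) / n) (ClopperPearson.zUpper a)|
        ≤ C * (n : ℝ) ^ (-(3 / 2) : ℝ) ∧
      |ClopperPearson.upper a n X
          - ClopperPearson.upperExp n ((X : ℝ) / n) (ClopperPearson.zUpper a)|
        ≤ C * (n : ℝ) ^ (-(3 / 2) : ℝ) ∧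
      |ClopperPearson.lower a n X
          - ClopperPearson.lowerExpRefined n ((X : ℝ) / n) (ClopperPearson.zUpper a)|
        ≤ C * (n : ℝ) ^ (-2 : ℝ) ∧
      |ClopperPearson.upper a n X
          - ClopperPearson.upperExpRefined n ((X : ℝ) / n) (ClopperPearson.zUpper a)|
        ≤ C * (n : ℝ) ^ (-2 : ℝ)) := by
  have ha0 : 0 < a := by rcases ha with rfl | rfl <;> linarith
  have ha1 : a < 1 := by rcases ha with rfl | rfl <;> linarith
  refine ⟨fun n X hX hXn => ⟨⟨ClopperPearson.lower_mem_Icc ha0 ha1 hX hXn.le,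
      fun p hp => ClopperPearson.binomGE_eq_iff_eq_lower ha0 ha1 hX hXn.le hp⟩,
    ⟨ClopperPearson.upper_mem_Icc ha0 ha1 hXn,
      fun p hp => ClopperPearson.binomLE_eq_iff_eq_upper ha0 ha1 hXn hp⟩⟩, fun δ hδ => ?_⟩
  obtain ⟨C, hC⟩ := ClopperPearson.exists_abs_lower_sub_le hδ ha0 ha1
  refine ⟨C, fun n X _ hXn hp hp' => ?_⟩
  have hn : 0 < n := Nat.zero_lt_of_lt hXn
  obtain ⟨hlower, hlower_refined⟩ := hC n X hn ⟨hp, hp'⟩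
  obtain ⟨hupper, hupper_refined⟩ := hC n (n - X) hn (by
    rw [ClopperPearson.natCast_sub_div_natCast hXn]
    constructor <;> linarith)
  rw [← ClopperPearson.abs_upper_sub_upperExp ha0 ha1 hXn] at hupper
  rw [← ClopperPearson.abs_upper_sub_upperExpRefined ha0 ha1 hXn] at hupper_refined
  exact ⟨hlower, hupper, hlower_refined, hupper_refined⟩
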